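/- **Theorem 3.2 (Converse Functional Calculus).** Let $A$ be a graded $C^*$-algebra (a complex $C^*$-algebra with a $*$-automorphism $\alpha$, $\alpha^2=\mathrm{id}$, and $A_n=\{a:\alpha(a)=(-1)^na\}$) and let $\mathcal H$ be a graded Hilbert $A$-module, that is, a Hilbert $A$-module with closed linear subspaces such that $\mathcal H=\mathcal H_0\oplus\mathcal H_1$, $\mathcal H_nA_m\subseteq\mathcal H_{n+m}$ and $\langle\mathcal H_n,\mathcal H_m\rangle\subseteq A_{n+m}$ (indices mod $2$). Let $\mathcal L(\mathcal H)$ be the $C^*$-algebra of adjointable operators, where $T$ has degree $m$ if $T\mathcal H_n\subseteq\mathcal H_{n+m}$ for $n=0,1$, and let $\mathcal K(\mathcal H)$ be the closed linear span of the operators $z\mapsto x\langle y,z\rangle$. Grade $C_0(\mathbb R)=C_0(\mathbb R,\mathbb C)$ by even and odd functions, and let $\varphi:C_0(\mathbb R)\to\mathcal L(\mathcal H)$ be a $*$-homomorphism that preserves degrees. Let $\mathcal H_\varphi$ be the closed linear span of $\varphi(C_0(\mathbb R))\mathcal H$. Then $\mathcal H_\varphi$ is a closed $\varphi$-invariant $A$-submodule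 of $\mathcal H$ which is graded, i.e. $\mathcal H_\varphi=(\mathcal H_\varphi\cap\mathcal H_0)\oplus(\mathcal H_\varphi\cap\mathcal H_1)$, and there is a self-adjoint regular operator $D$ on $\mathcal H_\varphi$ of degree one such that $$\varphi(f)x=f(D)x\qquad\text{for all } f\in C_0(\mathbb R),\ x\in\mathcal H_\varphi .$$ Moreover, this $D$ satisfies the following. 1. If $\varphi$ is strict, i.e. $(\varphi(u_i))$ is Cauchy in the strict topology of $\mathcal L(\mathcal H)$ for some approximate unit $(u_i)$ of $C_0(\mathbb R)$, then $\mathcal H_\varphi$ is complemented, $\mathcal H=\mathcal H_\varphi\oplus\mathcal H_\varphi^\perp$, and $\varphi(f)=f(D)$ for all $f\in C_0(\mathbb R)$ under the inclusion $\mathcal L(\mathcal H_\varphi)\subseteq\mathcal L(\mathcal H)$ that extends operators by $0$ on $\mathcal H_\varphi^\perp$. 2. If $\varphi$ is nondegenerate, i.e. the linear span of $\varphi(C_0(\mathbb R))\mathcal H$ is dense in $\mathcal H$, then $\mathcal H_\varphi=\mathcal H$. 3. If $\varphi(C_0(\mathbb R))\subseteq\mathcal K(\mathcal H)$, then $D$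 has compact resolvents: for every $z\in\mathbb C\setminus\mathbb R$ the inverse $(D-z)^{-1}$ exists and lies in $\mathcal K(\mathcal H_\varphi)$. Here a regular operator on a Hilbert $A$-module is a densely defined closed $A$-linear operator $D$ whose adjoint $D^*$ is densely defined and for which $1+D^*D$ has dense range; it is self-adjoint if $D=D^*$; it has degree one if its domain is graded and $D$ maps homogeneous elements of degree $n$ to elements of degree $n+1$. The strict topology on $\mathcal L(\mathcal H)$ is given by the seminorms $T\mapsto\|Tx\|$ and $T\mapsto\|T^*x\|$, $x\in\mathcal H$. For self-adjoint regular $D$, $f(D)$ denotes the functional calculus: $f(D)=\tilde f(U)$, where $U=(D-i)(D+i)^{-1}$ is the unitary Cayley transform of $D$ and $\tilde f$ is the continuous function on the unit circle with $\tilde f\big(\tfrac{t-i}{t+i}\big)=f(t)$ for $t\in\mathbb R$ and $\tilde f(1)=0$. -/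

import Mathlib

open scoped ZeroAtInfty

set_option linter.unusedSectionVars false

noncomputable section

namespace HilbertMod

/-! ### Graded C⋆-algebras -/

/-- A grading on a C⋆-algebra `A`: a `*`-automorphism whose square is the identity. -/
structure CStarGrading (A : Type*) [NonUnitalCStarAlgebra A] where
  /-- the grading automorphism -/
  aut : A ≃⋆ₐ[ℂ] A
  aut_aut : ∀ a, aut (aut a) = a

/-- The homogeneous part `A_n = {a | α(a) = (-1)ⁿ a}`, `n ∈ ℤ/2`. -/
def CStarGrading.part {A : Type*} [NonUnitalCStarAlgebra A] (α : CStarGrading A) (n : ZMod 2) :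
    Submodule ℂ A where
  carrier := {a | α.aut a = (-1 : ℂ) ^ n.val • a}
  add_mem' {a b} ha hb := by
    simp only [Set.mem_ofPred_eq] at *
    rw [map_add, ha, hb, smul_add]
  zero_mem' := by simp
  smul_mem' c a ha := by
    simp only [Set.mem_ofPred_eq] at *
    rw [map_smul, ha, smul_comm]

/-- The even-odd function grading of `C₀(ℝ)`: `α(f)(t) = f(-t)`. -/
def evenOddGrading : CStarGrading C₀(ℝ, ℂ) where
  aut :=
    { toFun := fun f => f.comp (Homeomorph.neg ℝ).toCocompactMap
      invFun := fun f => f.comp (Homeomorph.neg ℝ).toCocompactMap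
      left_inv := fun f => by ext t; simp
      right_inv := fun f => by ext t; simp
      map_mul' := fun f g => by ext t; simp
      map_add' := fun f g => by ext t; simp
      map_star' := fun f => by ext t; simp
      map_smul' := fun c f => by ext t; simp }
  aut_aut := fun f => by
    ext t
    change f (- -t) = f t
    rw [neg_neg]

/-! ### Adjointable operators on a Hilbert module

A Hilbert `A`-module is a complete `CStarModule A E`. Mathlib writes the module action on the
left, with `⟨x, a y⟩ = a ⟨x, y⟩`; right Hilbert modules over a C⋆-algebra `B` are covered by taking
`A = Bᵐᵒᵖ`. -/

variable (A E : Type*) [NonUnitalCStarAlgebra A] [PartialOrder A] [StarOrderedRing A]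
  [NormedAddCommGroup E] [NormedSpace ℂ E] [SMul A E] [CStarModule A E]

section basics

variable {A E}

theorem ext_inner {x y : E} (h : ∀ z : E, inner A z x = inner A z y) : x = y := by
  have h1 : inner A (x - y) (x - y) = 0 := by
    rw [CStarModule.inner_sub_right, h, sub_self]
  exact sub_eq_zero.mp (CStarModule.inner_self.mp h1)

theorem add_smul_alg (a b : A) (x : E) : (a + b) • x = a • x + b • x :=
  ext_inner (A := A) fun z => by simp [add_mul]

theorem smul_add_alg (a : A) (x y : E) : a • (x + y) = a • x + a • y :=
  ext_inner (A := A) fun z => by simp [mul_add]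

theorem smul_smul_alg (c : ℂ) (a : A) (x : E) : (c • a) • x = c • a • x :=
  ext_inner (A := A) fun z => by simp [smul_mul_assoc]

theorem le_of_sq_le_sq' {a b : ℝ} (h : a ^ 2 ≤ b ^ 2) (hb : 0 ≤ b) : a ≤ b :=
  (abs_le_of_sq_le_sq' h hb).2

theorem norm_smul_alg_le (a : A) (x : E) : ‖a • x‖ ≤ ‖a‖ * ‖x‖ := by
  have h : ‖a • x‖ ^ 2 ≤ (‖a‖ * ‖x‖) ^ 2 := by
    rw [CStarModule.norm_sq_eq A, CStarModule.inner_op_smul_right,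
      CStarModule.inner_op_smul_left, mul_pow, CStarModule.norm_sq_eq A (x := x)]
    calc ‖a * (inner A x x * star a)‖ ≤ ‖a‖ * (‖(inner A x x : A)‖ * ‖star a‖) :=
          (norm_mul_le _ _).trans (by gcongr; exact norm_mul_le _ _)
      _ = ‖a‖ ^ 2 * ‖(inner A x x : A)‖ := by rw [norm_star]; ring
  exact le_of_sq_le_sq' h (by positivity)

theorem norm_le_of_inner {x : E} {c : ℝ} (hc : 0 ≤ c)
    (h : ‖(inner A x x : A)‖ ≤ c * ‖x‖) : ‖x‖ ≤ c := by
  rw [← CStarModule.norm_sq_eq A, sq] at h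
  rcases (norm_nonneg x).eq_or_lt with h0 | h0
  · rw [← h0]; exact hc
  · exact le_of_mul_le_mul_right h h0

end basics

/-- The algebra of bounded `A`-linear maps on `E` possessing an adjoint. -/
def adjointable : Subalgebra ℂ (E →L[ℂ] E) where
  carrier := {T | (∀ (a : A) (x : E), T (a • x) = a • T x) ∧
    ∃ S : E →L[ℂ] E, ∀ x y, inner A (T x) y = inner A x (S y)}
  mul_mem' := by
    rintro T T' ⟨hT, S, hS⟩ ⟨hT', S', hS'⟩
    refine ⟨fun a x => ?_, S' * S, fun x y => ?_⟩
    · simp only [mul_apply_eq_comp, hT', hT]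
    · simp only [mul_apply_eq_comp, hS, hS']
  add_mem' := by
    rintro T T' ⟨hT, S, hS⟩ ⟨hT', S', hS'⟩
    refine ⟨fun a x => ?_, S + S', fun x y => ?_⟩
    · simp only [add_apply, hT', hT, smul_add_alg]
    · simp only [add_apply, CStarModule.inner_add_left,
        CStarModule.inner_add_right, hS, hS']
  algebraMap_mem' c := by
    refine ⟨fun a x => ?_, algebraMap ℂ _ (star c), fun x y => ?_⟩
    · refine ext_inner (A := A) fun z => ?_
      simp [Algebra.algebraMap_eq_smul_one, mul_smul_comm]
    · simp [Algebra.algebraMap_eq_smul_one]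

/-- `𝓛(E)`, the C⋆-algebra of adjointable operators on `E`, with the operator norm. -/
abbrev Adj : Type _ := adjointable A E

variable {A E}

namespace Adj

theorem exists_adjoint (T : Adj A E) :
    ∃ S : Adj A E, ∀ x y, inner A (T.1 x) y = inner A x (S.1 y) := by
  obtain ⟨hT, S, hS⟩ := T.2
  refine ⟨⟨S, fun a x => ext_inner (A := A) fun z => ?_, T.1, fun x y => ?_⟩, hS⟩
  · rw [← hS, CStarModule.inner_op_smul_right, CStarModule.inner_op_smul_right, hS]
  · rw [← CStarModule.star_inner, ← hS, CStarModule.star_inner]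

/-- The involution on `𝓛(E)` is the adjoint. -/
instance : Star (Adj A E) := ⟨fun T => T.exists_adjoint.choose⟩

theorem inner_left (T : Adj A E) (x y : E) : inner A (T.1 x) y = inner A x ((star T).1 y) :=
  T.exists_adjoint.choose_spec x y

theorem inner_right (T : Adj A E) (x y : E) : inner A x (T.1 y) = inner A ((star T).1 x) y := by
  rw [← CStarModule.star_inner, inner_left, CStarModule.star_inner]

theorem star_unique (T S : Adj A E) (h : ∀ x y, inner A (T.1 x) y = inner A x (S.1 y)) :
    star T = S :=
  Subtype.ext <| ContinuousLinearMap.ext fun y => ext_inner (A := A) fun x => by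
    rw [← inner_left, h]

instance : StarRing (Adj A E) where
  star_involutive T := star_unique _ _ fun x y => by rw [← inner_right]
  star_mul T S := star_unique _ _ fun x y => by
    change inner A (T.1 (S.1 x)) y = inner A x ((star S).1 ((star T).1 y))
    rw [inner_left, inner_left]
  star_add T S := star_unique _ _ fun x y => by
    change inner A (T.1 x + S.1 x) y = inner A x ((star T).1 y + (star S).1 y)
    rw [CStarModule.inner_add_left, CStarModule.inner_add_right, inner_left, inner_left]

instance : StarModule ℂ (Adj A E) where
  star_smul c T := star_unique _ _ fun x y => by
    change inner A (c • T.1 x) y = inner A x (star c • (star T).1 y)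
    rw [CStarModule.inner_smul_left_complex, CStarModule.inner_smul_right_complex, inner_left]

theorem norm_star_mul_ge (T : Adj A E) : ‖T‖ * ‖T‖ ≤ ‖star T * T‖ := by
  have h : ‖T‖ ≤ √‖star T * T‖ := by
    refine ContinuousLinearMap.opNorm_le_bound _ (Real.sqrt_nonneg _) fun x => ?_
    refine le_of_sq_le_sq' ?_ (by positivity)
    change ‖T.1 x‖ ^ 2 ≤ _
    rw [mul_pow, Real.sq_sqrt (norm_nonneg (star T * T)), CStarModule.norm_sq_eq A]
    have h1 : inner A (T.1 x) (T.1 x) = (inner A x ((star T * T).1 x) : A) := inner_left _ _ _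
    rw [h1]
    calc ‖(inner A x ((star T * T).1 x) : A)‖ ≤ ‖x‖ * ‖(star T * T).1 x‖ :=
          CStarModule.norm_inner_le E
      _ ≤ ‖x‖ * (‖star T * T‖ * ‖x‖) := by
          gcongr
          exact (star T * T).1.le_opNorm x
      _ = _ := by ring
  calc ‖T‖ * ‖T‖ ≤ √‖star T * T‖ * √‖star T * T‖ := by gcongr
    _ = _ := Real.mul_self_sqrt (norm_nonneg _)

instance : CStarRing (Adj A E) := ⟨norm_star_mul_ge⟩

instance [CompleteSpace E] : CompleteSpace (Adj A E) := by
  refine Metric.complete_of_cauchySeq_tendsto fun u hu => ?_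
  have hu1 : CauchySeq fun n => (u n).1 :=
    uniformContinuous_subtype_val.comp_cauchySeq hu
  have hu2 : CauchySeq fun n => (star (u n)).1 :=
    (uniformContinuous_subtype_val.comp
      (starₗᵢ ℂ : Adj A E ≃ₗᵢ⋆[ℂ] Adj A E).isometry.uniformContinuous).comp_cauchySeq hu
  obtain ⟨T, hT⟩ := cauchySeq_tendsto_of_complete hu1
  obtain ⟨S, hS⟩ := cauchySeq_tendsto_of_complete hu2
  have hTx : ∀ x, Filter.Tendsto (fun n => (u n).1 x) Filter.atTop (nhds (T x)) := fun x =>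
    ((ContinuousLinearMap.apply ℂ E x).continuous.tendsto T).comp hT
  have hSx : ∀ x, Filter.Tendsto (fun n => (star (u n)).1 x) Filter.atTop (nhds (S x)) :=
    fun x => ((ContinuousLinearMap.apply ℂ E x).continuous.tendsto S).comp hS
  have hadj : ∀ x y, inner A (T x) y = inner A x (S y) := fun x y => by
    have h1 : Filter.Tendsto (fun n => inner A ((u n).1 x) y) Filter.atTop
        (nhds (inner A (T x) y)) :=
      ((CStarModule.continuous_inner (A := A) (E := E)).tendsto (T x, y)).comp
        ((hTx x).prodMk_nhds tendsto_const_nhds)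
    have h2 : Filter.Tendsto (fun n => inner A x ((star (u n)).1 y)) Filter.atTop
        (nhds (inner A x (S y))) :=
      ((CStarModule.continuous_inner (A := A) (E := E)).tendsto (x, S y)).comp
        (tendsto_const_nhds.prodMk_nhds (hSx y))
    simp_rw [inner_left] at h1
    exact tendsto_nhds_unique h1 h2
  have hmem : T ∈ adjointable A E := by
    refine ⟨fun a x => ext_inner (A := A) fun z => ?_, S, hadj⟩
    rw [← CStarModule.star_inner, hadj, CStarModule.inner_op_smul_left, ← hadj,
      CStarModule.inner_op_smul_right, star_mul, star_star, CStarModule.star_inner]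
  exact ⟨⟨T, hmem⟩, tendsto_subtype_rng.mpr hT⟩

instance [CompleteSpace E] : CStarAlgebra (Adj A E) where

end Adj

variable (A) in
/-- The rank-one operator `θ_{x,y}`, mapping `z` to `⟨y, z⟩ x` (`x ⟨y, z⟩` for right modules). -/
def rankOne (x y : E) : Adj A E :=
  let θ (x y : E) : E →L[ℂ] E :=
    LinearMap.mkContinuous
      { toFun := fun z => (inner A y z : A) • x
        map_add' := fun z w => by rw [CStarModule.inner_add_right, add_smul_alg]
        map_smul' := fun c z => by
          rw [CStarModule.inner_smul_right_complex, smul_smul_alg, RingHom.id_apply] }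
      (‖y‖ * ‖x‖) fun z => by
        refine (norm_smul_alg_le (inner A y z : A) x).trans ?_
        calc ‖(inner A y z : A)‖ * ‖x‖ ≤ (‖y‖ * ‖z‖) * ‖x‖ := by
              gcongr
              exact CStarModule.norm_inner_le E
          _ = ‖y‖ * ‖x‖ * ‖z‖ := by ring
  ⟨θ x y, fun a z => ext_inner (A := A) fun w => by
      change inner A w ((inner A y (a • z) : A) • x) = inner A w (a • (inner A y z : A) • x)
      simp [mul_assoc],
    θ y x, fun z w => by
      change inner A ((inner A y z : A) • x) w = inner A z ((inner A x w : A) • y)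
      simp⟩

variable (A E) in
/-- `𝓚(E)`, the compact operators: the closed linear span of the rank-one operators. -/
def compacts : Submodule ℂ (Adj A E) :=
  (Submodule.span ℂ {T | ∃ x y : E, T = rankOne A x y}).topologicalClosure

/-! ### Gradings and submodules -/

/-- A grading of the Hilbert module `E` over the graded C⋆-algebra `(A, α)`: a Banach space
decomposition `E = E₀ ⊕ E₁` with `E_n A_m ⊆ E_{n+m}` and `⟨E_n, E_m⟩ ⊆ A_{n+m}`. -/
structure Grading (α : CStarGrading A) (E : Type*) [NormedAddCommGroup E] [NormedSpace ℂ E]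
    [SMul A E] [CStarModule A E] where
  part : ZMod 2 → Submodule ℂ E
  isClosed_part : ∀ n, IsClosed (part n : Set E)
  isCompl_part : IsCompl (part 0) (part 1)
  smul_mem : ∀ {n m : ZMod 2} {a : A} {x : E}, x ∈ part n → a ∈ α.part m → a • x ∈ part (n + m)
  inner_mem : ∀ {n m : ZMod 2} {x y : E}, x ∈ part n → y ∈ part m →
    inner A x y ∈ α.part (n + m)

/-- The induced grading on `𝓛(E)`: `T` has degree `m` if `T E_n ⊆ E_{n+m}`. -/
def HasDegree {α : CStarGrading A} (𝒢 : Grading α E) (m : ZMod 2) (T : Adj A E) : Prop :=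
  ∀ n, ∀ x ∈ 𝒢.part n, T.1 x ∈ 𝒢.part (n + m)

/-- A `*`-homomorphism `C₀(ℝ) → 𝓛(E)` is graded if it preserves degrees. -/
def IsGradedHom {α : CStarGrading A} (𝒢 : Grading α E) (φ : C₀(ℝ, ℂ) →⋆ₙₐ[ℂ] Adj A E) : Prop :=
  ∀ n, ∀ f ∈ evenOddGrading.part n, HasDegree 𝒢 n (φ f)

variable (A E) in
/-- A closed `A`-submodule of `E`. -/
structure HilbertSubmodule extends Submodule ℂ E where
  smul_alg_mem : ∀ (a : A) {x : E}, x ∈ toSubmodule → a • x ∈ toSubmodule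
  isClosed : IsClosed (toSubmodule : Set E)

namespace HilbertSubmodule

variable (F : HilbertSubmodule A E)

instance : SMul A F.toSubmodule := ⟨fun a x => ⟨a • x.1, F.smul_alg_mem a x.2⟩⟩

/-- A closed submodule is a Hilbert module, with the restricted inner product. -/
instance : CStarModule A F.toSubmodule where
  inner x y := inner A x.1 y.1
  inner_add_right := CStarModule.inner_add_right
  inner_self_nonneg := CStarModule.inner_self_nonneg
  inner_self := CStarModule.inner_self.trans Submodule.coe_eq_zero
  inner_op_smul_right := CStarModule.inner_op_smul_right
  inner_smul_right_complex := CStarModule.inner_smul_right_complex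
  star_inner x y := CStarModule.star_inner x.1 y.1
  norm_eq_sqrt_norm_inner_self x := CStarModule.norm_eq_sqrt_norm_inner_self x.1

instance [CompleteSpace E] : CompleteSpace F.toSubmodule := F.isClosed.completeSpace_coe

/-- `F` is invariant under the `*`-homomorphism `φ`. -/
def IsInvariant (φ : C₀(ℝ, ℂ) →⋆ₙₐ[ℂ] Adj A E) : Prop :=
  ∀ f, ∀ x ∈ F.toSubmodule, (φ f).1 x ∈ F.toSubmodule

/-- `F` is graded: `F = (F ∩ E₀) + (F ∩ E₁)`. -/
def IsGraded {α : CStarGrading A} (𝒢 : Grading α E) : Prop :=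
  ∀ x ∈ F.toSubmodule, ∃ x₀ ∈ F.toSubmodule, ∃ x₁ ∈ F.toSubmodule,
    x₀ ∈ 𝒢.part 0 ∧ x₁ ∈ 𝒢.part 1 ∧ x₀ + x₁ = x

/-- The grading `F_n = F ∩ E_n` of a graded submodule. -/
def grading {α : CStarGrading A} (𝒢 : Grading α E) (hF : F.IsGraded 𝒢) :
    Grading α F.toSubmodule where
  part n := (𝒢.part n).comap F.toSubmodule.subtype
  isClosed_part n := (𝒢.isClosed_part n).preimage continuous_subtype_val
  isCompl_part := by
    refine ⟨?_, ?_⟩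
    · rw [Submodule.disjoint_def]
      exact fun x h0 h1 => Subtype.ext (Submodule.disjoint_def.mp 𝒢.isCompl_part.disjoint _ h0 h1)
    · rw [codisjoint_iff, Submodule.eq_top_iff']
      intro x
      obtain ⟨x₀, h₀, x₁, h₁, hx₀, hx₁, h⟩ := hF x.1 x.2
      exact Submodule.mem_sup.mpr ⟨⟨x₀, h₀⟩, hx₀, ⟨x₁, h₁⟩, hx₁, Subtype.ext h⟩
  smul_mem hx ha := 𝒢.smul_mem hx ha
  inner_mem hx hy := 𝒢.inner_mem hx hy

/-- `F` is complemented: `E = F ⊕ F^⊥`. -/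
def IsComplemented : Prop :=
  ∀ x : E, ∃ y ∈ F.toSubmodule, ∃ z : E, (∀ w ∈ F.toSubmodule, inner A w z = 0) ∧ x = y + z

variable {F}

theorem IsComplemented.exists_proj (hF : F.IsComplemented) :
    ∃ P : E →L[ℂ] F.toSubmodule, ∀ (x : E) (w : F.toSubmodule),
      inner A w.1 (P x).1 = inner A w.1 x := by
  choose p hp q hq h using hF
  have key : ∀ (x : E) (w : F.toSubmodule), inner A w.1 (p x) = inner A w.1 x := fun x w => by
    conv_rhs => rw [h x]
    rw [CStarModule.inner_add_right, hq x w.1 w.2, add_zero]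
  refine ⟨LinearMap.mkContinuous
    { toFun := fun x => ⟨p x, hp x⟩
      map_add' := fun x y => ext_inner (A := A) fun w => ?_
      map_smul' := fun c x => ext_inner (A := A) fun w => ?_ } 1 fun x => ?_, key⟩
  · change inner A w.1 (p (x + y)) = inner A w.1 (p x + p y)
    simp [key]
  · change inner A w.1 (p (c • x)) = inner A w.1 (c • p x)
    simp [key]
  · rw [one_mul]
    change ‖p x‖ ≤ ‖x‖
    refine norm_le_of_inner (A := A) (norm_nonneg _) ?_
    rw [key x ⟨p x, hp x⟩, mul_comm]
    exact CStarModule.norm_inner_le E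

/-- The orthogonal projection of `E` onto a complemented submodule. -/
def IsComplemented.proj (hF : F.IsComplemented) : E →L[ℂ] F.toSubmodule :=
  hF.exists_proj.choose

theorem IsComplemented.inner_proj (hF : F.IsComplemented) (x : E) (w : F.toSubmodule) :
    inner A w (hF.proj x) = inner A w.1 x :=
  hF.exists_proj.choose_spec x w

/-- The inclusion `𝓛(F) ⊆ 𝓛(E)` for a complemented submodule `F`: `T` acts as `T` on `F` and as
`0` on `F^⊥`. -/
def IsComplemented.extend (hF : F.IsComplemented) (T : Adj A F.toSubmodule) : Adj A E :=
  ⟨F.toSubmodule.subtypeL.comp (T.1.comp hF.proj), by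
    have h : ∀ (S : Adj A F.toSubmodule) (x y : E),
        inner A (S.1 (hF.proj x)).1 y = inner A (S.1 (hF.proj x)) (hF.proj y) :=
      fun S x y => (hF.inner_proj y _).symm
    have hadj : ∀ x y : E, inner A (T.1 (hF.proj x)).1 y
        = inner A x ((star T).1 (hF.proj y)).1 := fun x y => by
      rw [h, Adj.inner_left, ← CStarModule.star_inner, ← h, CStarModule.star_inner]
    refine ⟨fun a x => ext_inner (A := A) fun z => ?_,
      F.toSubmodule.subtypeL.comp ((star T).1.comp hF.proj), hadj⟩
    change inner A z (T.1 (hF.proj (a • x))).1 = inner A z (a • (T.1 (hF.proj x)).1)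
    rw [← CStarModule.star_inner, hadj, CStarModule.inner_op_smul_left, ← hadj,
      CStarModule.inner_op_smul_right, star_mul, star_star, CStarModule.star_inner]⟩

end HilbertSubmodule

/-! ### Properties of `*`-homomorphisms into `𝓛(E)` -/

/-- A filter on `𝓛(E)` is Cauchy in the strict topology, which is given by the seminorms
`T ↦ ‖T x‖` and `T ↦ ‖T* x‖`, `x ∈ E`. -/
def StrictCauchy (l : Filter (Adj A E)) : Prop :=
  ∀ x : E, Cauchy (l.map fun T => T.1 x) ∧ Cauchy (l.map fun T => (star T).1 x)

/-- `φ` is strict: `(φ(u_i))` is strictly Cauchy for some approximate unit `(u_i)` of `C₀(ℝ)`. -/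
def IsStrict (φ : C₀(ℝ, ℂ) →⋆ₙₐ[ℂ] Adj A E) : Prop :=
  ∃ l : Filter C₀(ℝ, ℂ), l.IsApproximateUnit ∧ StrictCauchy (l.map φ)

/-- The closed linear span of `φ(C₀(ℝ)) E`. -/
def essentialSubspace (φ : C₀(ℝ, ℂ) →⋆ₙₐ[ℂ] Adj A E) : Submodule ℂ E :=
  (Submodule.span ℂ {y | ∃ f x, y = (φ f).1 x}).topologicalClosure

/-- `φ` is nondegenerate: the span of `φ(C₀(ℝ)) E` is dense in `E`. -/
def IsNondegenerate (φ : C₀(ℝ, ℂ) →⋆ₙₐ[ℂ] Adj A E) : Prop :=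
  Dense (Submodule.span ℂ {y | ∃ f x, y = (φ f).1 x} : Set E)

/-! ### Regular operators -/

variable (A) in
/-- The graph of the adjoint of `D`: pairs `(y, z)` with `⟨D x, y⟩ = ⟨x, z⟩` for all `x` in the
domain of `D`. -/
def adjointGraph (D : E →ₗ.[ℂ] E) : Submodule ℂ (E × E) where
  carrier := {p | ∀ x : D.domain, inner A (D x) p.1 = inner A x.1 p.2}
  add_mem' {p q} hp hq x := by
    simp only [Prod.fst_add, Prod.snd_add, CStarModule.inner_add_right, hp x, hq x]
  zero_mem' x := by simp
  smul_mem' c p hp x := by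
    simp only [Prod.smul_fst, Prod.smul_snd, CStarModule.inner_smul_right_complex, hp x]

variable (A) in
/-- Regular operators: densely defined closed `A`-linear maps `D` such that `D*` is densely
defined and `1 + D*D` has dense range. -/
structure IsRegular (D : E →ₗ.[ℂ] E) : Prop where
  dense_domain : Dense (D.domain : Set E)
  isClosed : D.IsClosed
  map_smul_alg : ∀ (a : A) (x : D.domain), ∃ h : a • x.1 ∈ D.domain, D ⟨a • x.1, h⟩ = a • D x
  dense_adjoint : Dense {y : E | ∃ z, (y, z) ∈ adjointGraph A D}
  dense_range : Dense {w : E | ∃ (x : D.domain) (z : E),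
    (D x, z) ∈ adjointGraph A D ∧ w = x.1 + z}

variable (A) in
/-- `D = D*`, as an equality of graphs. -/
def IsSelfAdjointOp (D : E →ₗ.[ℂ] E) : Prop :=
  adjointGraph A D = D.graph

/-- `D` has degree one: its domain is graded and `D` maps `Domain(D) ∩ E_n` into `E_{n+1}`. -/
def HasDegreeOne {α : CStarGrading A} (𝒢 : Grading α E) (D : E →ₗ.[ℂ] E) : Prop :=
  (∀ x ∈ D.domain, ∃ x₀ ∈ D.domain, ∃ x₁ ∈ D.domain,
    x₀ ∈ 𝒢.part 0 ∧ x₁ ∈ 𝒢.part 1 ∧ x₀ + x₁ = x) ∧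
  ∀ (n : ZMod 2) (x : D.domain), x.1 ∈ 𝒢.part n → D x ∈ 𝒢.part (n + 1)

/-- `R = (D - z)⁻¹`. -/
def IsResolvent (D : E →ₗ.[ℂ] E) (z : ℂ) (R : Adj A E) : Prop :=
  (∀ y : E, ∃ x : D.domain, x.1 = R.1 y ∧ D x - z • x.1 = y) ∧
  ∀ x : D.domain, R.1 (D x - z • x.1) = x.1

variable (A) in
/-- `D` has compact resolvents: `(D - z)⁻¹` exists and belongs to `𝓚(E)` for all nonreal `z`. -/
def HasCompactResolvents (D : E →ₗ.[ℂ] E) : Prop :=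
  ∀ z : ℂ, z.im ≠ 0 → ∃ R ∈ compacts A E, IsResolvent D z R

open Classical in
variable (A) in
/-- The resolvent `(D - z)⁻¹` (and `0` if it does not exist). -/
def resolventOp (D : E →ₗ.[ℂ] E) (z : ℂ) : Adj A E :=
  if h : ∃ R : Adj A E, IsResolvent D z R then h.choose else 0

variable (A) in
/-- The Cayley transform `(D - i)(D + i)⁻¹ = 1 - 2i (D + i)⁻¹`, a unitary if `D` is self-adjoint
and regular. -/
def cayley (D : E →ₗ.[ℂ] E) : Adj A E :=
  1 - (2 * Complex.I) • resolventOp A D (-Complex.I)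

variable (A) in
/-- The functional calculus `f(D) ∈ 𝓛(E)` of a self-adjoint regular operator, for `f ∈ C₀(ℝ)`.
The map `t ↦ (t - i)/(t + i)` identifies `ℝ` with the unit circle without `1`, with inverse
`w ↦ i(1 + w)/(1 - w)`. It transports `f` to a continuous function on the circle, with value `0`
at `1`, and this is applied to the Cayley transform of `D` by the continuous functional calculus
for normal elements of the C⋆-algebra `𝓛(E)`. -/
def functionalCalculus [CompleteSpace E] (D : E →ₗ.[ℂ] E) (f : C₀(ℝ, ℂ)) : Adj A E :=
  open Classical in
  cfc (fun w : ℂ => if w = 1 then 0 else f (Complex.I * (1 + w) / (1 - w)).re) (cayley A D)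

end HilbertMod

end

noncomputable section

namespace HilbertMod

/-! ### Resolvent functions on the real line -/

/-! If `φ(f) = f(D)`, then `(D + i)⁻¹` must be `φ(r)` with `r(t) = (t + i)⁻¹`. So let `R` be the
restriction of `φ(r)` to `ℋ_φ` and put `D = R⁻¹ - i`. Three properties of `R` suffice
(`IsResolventLike`): it commutes with `R*`, it satisfies the resolvent identity `R* = R + 2i R R*`,
and it has dense range. The first two are identities in `C₀(ℝ)` transported by `φ`; the third holds
because `r · C₀(ℝ)` is dense in `C₀(ℝ)` (`dense_range_resolventFun_mul`). They make `R` injective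
and give `R* = (D - i)⁻¹`, whence `D = D*`, and `R R* = (1 + D²)⁻¹`, whence regularity.

The Cayley map makes `C(𝕋)` the unitization of `C₀(ℝ)`, so the restricted `φ` extends to a unital
`*`-homomorphism on `C(𝕋)`. It sends the coordinate function to `1 - 2iR`, the Cayley transform of
`D`, and the continuous functional calculus is the only such homomorphism (`cfc_circleFun`).

For the degree, `R` is not homogeneous, but `R + R*` is odd, `R R*` is even, and these two determine
the graph of `D`. In the strict case the projection onto `ℋ_φ` is the strong limit of `φ(u)` along
the approximate unit. In the compact case `ℋ_φ` need not be complemented, so compactness is carried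
to it by the maps `T ↦ φ(a) T φ(b)`. -/

theorem ofReal_sub_ne_zero {z : ℂ} (hz : z.im ≠ 0) (t : ℝ) : (t : ℂ) - z ≠ 0 := fun h => hz <| by
  simpa using congrArg Complex.im h

/-- The function `t ↦ (t - z)⁻¹` in `C₀(ℝ)`, for nonreal `z`. -/
def resolventFun (z : ℂ) (hz : z.im ≠ 0) : C₀(ℝ, ℂ) where
  toFun t := ((t : ℂ) - z)⁻¹
  continuous_toFun := by
    refine Continuous.inv₀ (by fun_prop) (ofReal_sub_ne_zero hz)
  zero_at_infty' := by
    refine Filter.tendsto_inv₀_cobounded.comp ?_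
    rw [← tendsto_norm_atTop_iff_cobounded]
    refine Filter.tendsto_atTop_mono (f := fun t : ℝ => ‖t‖ - ‖z‖) (fun t => ?_) ?_
    · simpa using norm_sub_norm_le (t : ℂ) z
    · exact Filter.tendsto_atTop_add_const_right _ _ (tendsto_norm_cocompact_atTop (E := ℝ))

@[simp]
theorem resolventFun_apply (z : ℂ) (hz : z.im ≠ 0) (t : ℝ) :
    resolventFun z hz t = ((t : ℂ) - z)⁻¹ := rfl

/-- The first resolvent identity. Its image under `φ` yields both the relation between `R` and `R*`
and all other resolvents of `D`. -/
theorem resolventFun_eq_add (z w : ℂ) (hz : z.im ≠ 0) (hw : w.im ≠ 0) :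
    resolventFun z hz
      = resolventFun w hw + (z - w) • (resolventFun w hw * resolventFun z hz) := by
  ext t
  have h1 := ofReal_sub_ne_zero hz t
  have h2 := ofReal_sub_ne_zero hw t
  simp only [ZeroAtInftyContinuousMap.add_apply, ZeroAtInftyContinuousMap.smul_apply,
    ZeroAtInftyContinuousMap.mul_apply, resolventFun_apply, smul_eq_mul]
  field_simp
  ring

theorem I_im_ne_zero : Complex.I.im ≠ 0 := by simp

theorem neg_I_im_ne_zero : (-Complex.I).im ≠ 0 := by simp

/-- The function `t ↦ (t + i)⁻¹` in `C₀(ℝ)`. -/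
abbrev resolventNegI : C₀(ℝ, ℂ) := resolventFun (-Complex.I) neg_I_im_ne_zero

theorem star_resolventNegI_eq : star resolventNegI = resolventFun Complex.I I_im_ne_zero := by
  ext t
  simp [sub_eq_add_neg]

theorem star_resolventNegI :
    star resolventNegI = resolventNegI + (2 * Complex.I) • (resolventNegI * star resolventNegI) := by
  rw [star_resolventNegI_eq, two_mul, ← sub_neg_eq_add Complex.I Complex.I]
  exact resolventFun_eq_add _ _ _ _

/-- The functions `-in / (t - in)` are bounded by `1`, tend to `1` locally uniformly as `n → ∞`, and
decay fast enough to be divided by `(t - z)⁻¹`. Multiplying `f` by them therefore approximates `f`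
from within the range. -/
theorem dense_range_resolventFun_mul (z : ℂ) (hz : z.im ≠ 0) :
    DenseRange fun g : C₀(ℝ, ℂ) => resolventFun z hz * g := by
  intro f
  rw [Metric.mem_closure_iff]
  intro ε hε
  have hf := f.zero_at_infty'
  rw [Metric.tendsto_nhds] at hf
  have h0 := hf (ε / 2) (by positivity)
  rw [Metric.cobounded_eq_cocompact.symm, Metric.hasBasis_cobounded_compl_closedBall (0 : ℝ)
    |>.eventually_iff] at h0
  obtain ⟨M, -, hM⟩ := h0
  obtain ⟨n, hn⟩ := exists_nat_gt (‖f‖ * |M| / (ε / 2))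
  have hn0 : (0 : ℝ) < n := lt_of_le_of_lt (by positivity) hn
  have hz' : (Complex.I * n).im ≠ 0 := by simpa using hn0.ne'
  have hn' : ‖f‖ * |M| < n * (ε / 2) := by
    rwa [div_lt_iff₀ (by positivity)] at hn
  -- Since `1 + (in - z) / (t - in) = (t - z) / (t - in)`, this witness times `(t - z)⁻¹` is `f ·
  -- (-in) / (t - in)`, and the error is `f · t / (t - in)`. For `|t| ≤ |M|` the quotient is at most
  -- `|M| / n`; beyond that it is at most `1` and `f` is small.
  refine ⟨_, ⟨(-(Complex.I * n)) • (f + (Complex.I * n - z) • (f * resolventFun _ hz')), rfl⟩, ?_⟩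
  rw [dist_eq_norm]
  refine lt_of_le_of_lt ?_ (half_lt_self hε)
  rw [← ZeroAtInftyContinuousMap.norm_toBCF_eq_norm]
  refine (BoundedContinuousFunction.norm_le (by positivity)).mpr fun t => ?_
  have h1 := ofReal_sub_ne_zero hz t
  have h2 := ofReal_sub_ne_zero hz' t
  have key : f t - (t - z)⁻¹ * (-(Complex.I * n) * (f t + (Complex.I * n - z)
      * (f t * (t - Complex.I * n)⁻¹))) = f t * (t / (t - Complex.I * n)) := by
    field_simp
    ring
  have hden1 : |t| ≤ ‖(t : ℂ) - Complex.I * n‖ := by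
    simpa using Complex.abs_re_le_norm ((t : ℂ) - Complex.I * n)
  have hden2 : (n : ℝ) ≤ ‖(t : ℂ) - Complex.I * n‖ := by
    simpa using Complex.abs_im_le_norm ((t : ℂ) - Complex.I * n)
  have hpos := norm_pos_iff.mpr h2
  change ‖f t - (t - z)⁻¹ * (-(Complex.I * n) * (f t + (Complex.I * n - z)
      * (f t * (t - Complex.I * n)⁻¹)))‖ ≤ _
  rw [key, norm_mul, norm_div, Complex.norm_real, Real.norm_eq_abs]
  rcases le_or_gt |t| |M| with ht | ht
  · rw [mul_div_assoc', div_le_iff₀ hpos]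
    have h3 : ‖f t‖ ≤ ‖f‖ := by
      rw [← ZeroAtInftyContinuousMap.norm_toBCF_eq_norm]
      exact f.toBCF.norm_coe_le_norm t
    calc ‖f t‖ * |t| ≤ ‖f‖ * |M| := by gcongr
      _ ≤ n * (ε / 2) := hn'.le
      _ ≤ _ := by rw [mul_comm]; gcongr
  · have h3 : ‖f t‖ < ε / 2 := by
      have := @hM t (by simpa using (le_abs_self M).trans_lt ht)
      simpa using this
    calc ‖f t‖ * (|t| / ‖(t : ℂ) - Complex.I * n‖) ≤ ‖f t‖ * 1 := by
          gcongr
          exact div_le_one_of_le₀ hden1 (norm_nonneg _)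
      _ ≤ _ := by rw [mul_one]; exact h3.le

/-! ### The Cayley transform and the functional calculus -/

/-- The function on the circle corresponding to `f ∈ C₀(ℝ)` under the Cayley transform. -/
def circleFun (f : C₀(ℝ, ℂ)) (w : ℂ) : ℂ :=
  open Classical in if w = 1 then 0 else f (Complex.I * (1 + w) / (1 - w)).re

theorem im_cayley_symm_eq_zero {w : ℂ} (hw : w ∈ Metric.sphere (0 : ℂ) 1) :
    (Complex.I * (1 + w) / (1 - w)).im = 0 := by
  have h : (starRingEnd ℂ) w * w = 1 := by
    rw [Complex.conj_mul', mem_sphere_zero_iff_norm.mp hw]; simp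
  rw [← Complex.conj_eq_iff_im]
  -- At `w = 1` the quotient is a division by zero, with value `0`, so the claim still holds.
  rcases eq_or_ne w 1 with rfl | h1
  · simp
  have h2 : 1 - w ≠ 0 := sub_ne_zero.mpr h1.symm
  have h3 : 1 - (starRingEnd ℂ) w ≠ 0 := fun h4 => h2 <| by
    simpa using congrArg (starRingEnd ℂ) h4
  simp only [map_div₀, map_mul, Complex.conj_I, map_add, map_one, map_sub]
  rw [div_eq_div_iff h3 h2]
  linear_combination (2 * Complex.I) * h

/-- Only `w = 1` needs an argument: there the inverse Cayley map leaves every compact set of `ℝ`,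
and `f` vanishes at infinity. -/
theorem continuousOn_circleFun (f : C₀(ℝ, ℂ)) :
    ContinuousOn (circleFun f) (Metric.sphere (0 : ℂ) 1) := by
  intro w hw
  rcases eq_or_ne w 1 with rfl | h1
  · rw [← continuousWithinAt_sdiff_self]
    have h0 : circleFun f 1 = 0 := if_pos rfl
    have h1 : Filter.Tendsto (fun w : ℂ => (Complex.I * (1 + w) / (1 - w)).re)
        (nhdsWithin 1 (Metric.sphere (0 : ℂ) 1 \ {1})) (Filter.cocompact ℝ) := by
      rw [← Metric.cobounded_eq_cocompact, ← tendsto_norm_atTop_iff_cobounded]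
      have h2 : Filter.Tendsto (fun w : ℂ => ‖1 + w‖ * ‖1 - w‖⁻¹)
          (nhdsWithin 1 (Metric.sphere (0 : ℂ) 1 \ {1})) Filter.atTop := by
        refine Filter.Tendsto.pos_mul_atTop (C := ‖(1 + 1 : ℂ)‖) (by simp) ?_ ?_
        · exact (Continuous.tendsto (by fun_prop) (1 : ℂ)).mono_left nhdsWithin_le_nhds
        · refine Filter.Tendsto.inv_tendsto_nhdsGT_zero (tendsto_nhdsWithin_iff.mpr ⟨?_, ?_⟩)
          · have : Filter.Tendsto (fun w : ℂ => ‖1 - w‖) (nhds 1) (nhds ‖(1 - 1 : ℂ)‖) :=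
              Continuous.tendsto (by fun_prop) (1 : ℂ)
            rw [sub_self, norm_zero] at this
            exact this.mono_left nhdsWithin_le_nhds
          · filter_upwards [self_mem_nhdsWithin] with w hw
            exact norm_pos_iff.mpr (sub_ne_zero.mpr fun h => hw.2 h.symm)
      refine h2.congr' ?_
      filter_upwards [self_mem_nhdsWithin] with w hw
      -- On the circle the inverse Cayley map is real, so its real part has the full modulus `|1 +
      -- w| / |1 - w|`.
      rw [Real.norm_eq_abs, Complex.abs_re_eq_norm.mpr (im_cayley_symm_eq_zero hw.1)]
      simp [div_eq_mul_inv]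
    rw [ContinuousWithinAt, h0]
    refine (f.zero_at_infty'.comp h1).congr' ?_
    filter_upwards [self_mem_nhdsWithin] with w hw
    exact (if_neg hw.2).symm
  · refine ContinuousAt.continuousWithinAt ?_
    have h2 : 1 - w ≠ 0 := sub_ne_zero.mpr h1.symm
    have h3 : ContinuousAt (fun w : ℂ => f (Complex.I * (1 + w) / (1 - w)).re) w := by
      refine f.continuous.continuousAt.comp (Complex.continuous_re.continuousAt.comp ?_)
      exact ContinuousAt.div (by fun_prop) (by fun_prop) h2
    refine h3.congr ?_
    filter_upwards [isOpen_ne.mem_nhds h1] with v hv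
    rw [circleFun, if_neg hv]

/-- The Cayley transform `ℝ → 𝕋`, `t ↦ (t - i) / (t + i)`. -/
def cayleyFun : C(ℝ, Metric.sphere (0 : ℂ) 1) where
  toFun t := ⟨1 - 2 * Complex.I * resolventNegI t, by
    have h1 : (t : ℂ) + Complex.I ≠ 0 := by
      simpa using ofReal_sub_ne_zero neg_I_im_ne_zero t
    have h2 : 1 - 2 * Complex.I * resolventNegI t
        = (starRingEnd ℂ) (t + Complex.I) / (t + Complex.I) := by
      simp only [resolventFun_apply, sub_neg_eq_add, map_add, Complex.conj_ofReal, Complex.conj_I]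
      field_simp
      ring
    rw [mem_sphere_zero_iff_norm, h2, norm_div, Complex.norm_conj,
      div_self (norm_ne_zero_iff.mpr h1)]⟩
  continuous_toFun := by
    refine Continuous.subtype_mk ?_ _
    fun_prop

theorem cayleyFun_apply (t : ℝ) :
    (cayleyFun t : ℂ) = 1 - 2 * Complex.I * resolventNegI t := rfl

theorem circleFun_cayleyFun (f : C₀(ℝ, ℂ)) (t : ℝ) : circleFun f (cayleyFun t) = f t := by
  have h1 : (t : ℂ) + Complex.I ≠ 0 := by
    simpa using ofReal_sub_ne_zero neg_I_im_ne_zero t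
  have h2 : (cayleyFun t : ℂ) ≠ 1 := by
    simp [cayleyFun_apply, h1]
  rw [circleFun, if_neg h2, cayleyFun_apply]
  congr
  have : Complex.I * (1 + (1 - 2 * Complex.I * resolventNegI t))
      / (1 - (1 - 2 * Complex.I * resolventNegI t)) = t := by
    simp only [resolventFun_apply, sub_neg_eq_add]
    field_simp
    ring
  rw [this, Complex.ofReal_re]

/-- The pullback of a function on the circle along the Cayley transform, normalized to vanish at
infinity. -/
def cayleyPullback (g : C(Metric.sphere (0 : ℂ) 1, ℂ)) : C₀(ℝ, ℂ) where
  toFun t := g (cayleyFun t) - g ⟨1, by simp⟩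
  continuous_toFun := by fun_prop
  zero_at_infty' := by
    have h : Filter.Tendsto (fun t => g (cayleyFun t) - g ⟨1, by simp⟩) (Filter.cocompact ℝ)
        (nhds (g ⟨1, by simp⟩ - g ⟨1, by simp⟩)) := by
      refine Filter.Tendsto.sub_const ((g.continuous.tendsto _).comp ?_) _
      rw [tendsto_subtype_rng]
      have h := (resolventNegI.zero_at_infty'.const_mul (2 * Complex.I)).const_sub 1
      rw [mul_zero, sub_zero] at h
      exact h
    rwa [sub_self] at h

theorem cayleyPullback_apply (g : C(Metric.sphere (0 : ℂ) 1, ℂ)) (t : ℝ) :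
    cayleyPullback g t = g (cayleyFun t) - g ⟨1, by simp⟩ := rfl

section cayleyHom

variable {B : Type*} [CStarAlgebra B] (ψ : C₀(ℝ, ℂ) →⋆ₙₐ[ℂ] B)

/-- The unital extension of a `*`-homomorphism on `C₀(ℝ)` to the continuous functions on the
circle. -/
def cayleyHom : C(Metric.sphere (0 : ℂ) 1, ℂ) →⋆ₐ[ℂ] B where
  toFun g := ψ (cayleyPullback g) + algebraMap ℂ B (g ⟨1, by simp⟩)
  map_one' := by
    have : cayleyPullback 1 = 0 := by ext t; simp [cayleyPullback_apply]
    simp [this]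
  map_zero' := by
    have : cayleyPullback 0 = 0 := by ext t; simp [cayleyPullback_apply]
    simp [this]
  map_mul' g h := by
    -- Expansion of `gh - g(1)h(1)` in terms of `g - g(1)` and `h - h(1)`: multiplication in the
    -- unitization.
    have : cayleyPullback (g * h) = cayleyPullback g * cayleyPullback h
        + g ⟨1, by simp⟩ • cayleyPullback h + h ⟨1, by simp⟩ • cayleyPullback g := by
      ext t
      simp only [cayleyPullback_apply, ZeroAtInftyContinuousMap.add_apply,
        ZeroAtInftyContinuousMap.smul_apply, ZeroAtInftyContinuousMap.mul_apply,
        ContinuousMap.mul_apply, smul_eq_mul]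
      ring
    simp only [this, map_add, map_mul, map_smul, ContinuousMap.mul_apply,
      Algebra.algebraMap_eq_smul_one, add_mul, mul_add, smul_mul_assoc, mul_smul_comm, one_mul,
      mul_one, smul_smul, smul_add]
    rw [mul_comm]
    abel
  map_add' g h := by
    have : cayleyPullback (g + h) = cayleyPullback g + cayleyPullback h := by
      ext t
      simp only [cayleyPullback_apply, ZeroAtInftyContinuousMap.add_apply, ContinuousMap.add_apply]
      ring
    simp only [this, map_add, ContinuousMap.add_apply]
    abel
  commutes' c := by
    have : cayleyPullback (algebraMap ℂ _ c) = 0 := by ext t; simp [cayleyPullback_apply]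
    simp [this]
  map_star' g := by
    have : cayleyPullback (star g) = star (cayleyPullback g) := by
      ext t; simp [cayleyPullback_apply]
    simp only [this, map_star, ContinuousMap.star_apply, star_add]
    rw [algebraMap_star_comm]

theorem cayleyHom_apply (g : C(Metric.sphere (0 : ℂ) 1, ℂ)) :
    cayleyHom ψ g = ψ (cayleyPullback g) + algebraMap ℂ B (g ⟨1, by simp⟩) := rfl

theorem cayleyHom_id : cayleyHom ψ (.restrict _ (.id ℂ))
    = 1 - (2 * Complex.I) • ψ resolventNegI := by
  have : cayleyPullback (.restrict _ (.id ℂ)) = -((2 * Complex.I) • resolventNegI) := by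
    ext t
    simp [cayleyPullback_apply, cayleyFun_apply]
  rw [cayleyHom_apply, this, map_neg, map_smul]
  simp [sub_eq_neg_add]

/-- A `*`-homomorphism on `C₀(ℝ)` is the functional calculus of the Cayley transform of the image
of `(t + i)⁻¹`. -/
theorem cfc_circleFun (f : C₀(ℝ, ℂ)) :
    cfc (circleFun f) (1 - (2 * Complex.I) • ψ resolventNegI) = ψ f := by
  set U : B := 1 - (2 * Complex.I) • ψ resolventNegI with hU
  have hid := cayleyHom_id ψ
  rw [← hU] at hid
  have hunit : U ∈ unitary B := by
    have h1 : (ContinuousMap.restrict (Metric.sphere (0 : ℂ) 1) (.id ℂ)) ∈ unitary _ := by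
      rw [Unitary.mem_iff, and_iff_left_of_imp (fun h => by rwa [mul_comm])]
      ext w
      have := mem_sphere_zero_iff_norm.mp w.2
      simp [Complex.conj_mul', this]
    rw [← hid]
    exact Unitary.map_mem (cayleyHom ψ) h1
  have hn : IsStarNormal U := isStarNormal_of_mem_unitary hunit
  have hs : spectrum ℂ U ⊆ Metric.sphere 0 1 := spectrum.subset_circle_of_unitary hunit
  -- Both sides are continuous unital `*`-homomorphisms on `C(𝕋)` with the same value on the
  -- coordinate function, so they agree by Stone–Weierstrass.
  have hext : cfcHomSuperset hn hs = cayleyHom ψ := by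
    refine ContinuousMap.starAlgHom_ext_map_X (cfcHomSuperset_continuous hn hs)
      (AddMonoidHomClass.continuous_of_bound (cayleyHom ψ) 1 fun g => ?_) ?_
    · rw [one_mul]
      exact NonUnitalStarAlgHom.norm_apply_le (cayleyHom ψ) g
    have : Polynomial.toContinuousMapOnAlgHom (Metric.sphere (0 : ℂ) 1) Polynomial.X
        = .restrict _ (.id ℂ) := by ext; simp
    rw [this, cfcHomSuperset_id, hid]
  have hc := continuousOn_circleFun f
  have h1 : cfc (circleFun f) U = cfcHomSuperset hn hs ⟨_, hc.domRestrict⟩ := by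
    rw [cfcHomSuperset_apply, cfc_apply _ _ hn (hc.mono hs)]
    rfl
  -- The normalization subtracts nothing, because `circleFun f` is `0` at `1`.
  have h2 : cayleyPullback ⟨_, hc.domRestrict⟩ = f := by
    ext t
    rw [cayleyPullback_apply]
    simp only [ContinuousMap.coe_mk, Set.domRestrict_apply, circleFun_cayleyFun]
    simp [circleFun]
  rw [h1, hext, cayleyHom_apply, h2]
  simp [circleFun]

end cayleyHom

variable {A E : Type*} [NonUnitalCStarAlgebra A] [PartialOrder A] [StarOrderedRing A]
  [NormedAddCommGroup E] [NormedSpace ℂ E] [SMul A E] [CStarModule A E]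

/-! ### The operator with a given resolvent -/

theorem Adj.map_smul_alg (T : Adj A E) (a : A) (x : E) : T.1 (a • x) = a • T.1 x := T.2.1 a x

/-- The graph of `R⁻¹ - i`. -/
def resolventGraph (R : Adj A E) : Submodule ℂ (E × E) where
  carrier := {p | R.1 (p.2 + Complex.I • p.1) = p.1}
  add_mem' {p q} hp hq := by
    simp only [Set.mem_ofPred_eq, Prod.fst_add, Prod.snd_add] at *
    rw [smul_add, add_add_add_comm, map_add, hp, hq]
  zero_mem' := by simp
  smul_mem' c p hp := by
    simp only [Set.mem_ofPred_eq, Prod.smul_fst, Prod.smul_snd] at *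
    rw [smul_comm Complex.I c, ← smul_add, map_smul, hp]

theorem mem_resolventGraph {R : Adj A E} {x v : E} :
    (x, v) ∈ resolventGraph R ↔ R.1 (v + Complex.I • x) = x := Iff.rfl

/-- The operator `R⁻¹ - i`. -/
def ofResolvent (R : Adj A E) : E →ₗ.[ℂ] E := (resolventGraph R).toLinearPMap

/-- The properties of `R` that make it the resolvent `(D + i)⁻¹` of a self-adjoint regular
operator. -/
structure IsResolventLike (R : Adj A E) : Prop where
  star_eq : star R = R + (2 * Complex.I) • (R * star R)
  comm : R * star R = star R * R
  denseRange : DenseRange R.1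

namespace IsResolventLike

variable {R : Adj A E} (hR : IsResolventLike R)
include hR

theorem star_apply (x : E) :
    (star R).1 x = R.1 x + (2 * Complex.I) • R.1 ((star R).1 x) :=
  congrArg (fun T : Adj A E => T.1 x) hR.star_eq

theorem comm_apply (x : E) : R.1 ((star R).1 x) = (star R).1 (R.1 x) :=
  congrArg (fun T : Adj A E => T.1 x) hR.comm

/-- The resolvent identity and commutation give `ker R ⊆ ker R*`, and `ker R*` is orthogonal to the
dense range of `R`. Injectivity is what makes `R⁻¹ - i` single-valued. -/
theorem eq_zero_of_apply {x : E} (hx : R.1 x = 0) : x = 0 := by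
  have h1 : (star R).1 x = 0 := by
    rw [hR.star_apply, hR.comm_apply, hx]
    simp
  have h2 : Set.EqOn (fun w => (inner A w x : A)) (fun _ => 0) (Set.range R.1) := by
    rintro _ ⟨w, rfl⟩
    simp only
    rw [Adj.inner_left, h1, CStarModule.inner_zero_right]
  have hc : Continuous fun w : E => (inner A w x : A) :=
    CStarModule.continuous_inner.comp (by fun_prop : Continuous fun w : E => (w, x))
  have h3 := Continuous.ext_on hR.denseRange hc continuous_const h2
  exact CStarModule.inner_self.mp (congrFun h3 x)

theorem graph_eq : (ofResolvent R).graph = resolventGraph R := by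
  refine Submodule.toLinearPMap_graph_eq _ ?_
  rintro ⟨x, v⟩ hx (rfl : x = 0)
  rw [mem_resolventGraph, smul_zero, add_zero] at hx
  exact hR.eq_zero_of_apply hx

theorem apply_mem (x : (ofResolvent R).domain) :
    R.1 (ofResolvent R x + Complex.I • x.1) = x.1 := by
  rw [← mem_resolventGraph, ← hR.graph_eq]
  exact LinearPMap.mem_graph _ x

theorem exists_of_mem {x v : E} (h : R.1 (v + Complex.I • x) = x) :
    ∃ hx : x ∈ (ofResolvent R).domain, ofResolvent R ⟨x, hx⟩ = v := by
  rw [← mem_resolventGraph, ← hR.graph_eq, LinearPMap.mem_graph_iff] at h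
  obtain ⟨y, rfl, hy⟩ := h
  exact ⟨y.2, hy⟩

/-- This says `R* = (D - i)⁻¹`. The resolvent identity exchanges the two descriptions of the graph.
-/
theorem mem_resolventGraph_iff_star {x v : E} :
    (x, v) ∈ resolventGraph R ↔ (star R).1 (v - Complex.I • x) = x := by
  rw [mem_resolventGraph]
  constructor <;> intro h
  · have h1 := hR.star_apply (v + Complex.I • x)
    rw [hR.comm_apply, h] at h1
    have h2 : v - Complex.I • x = v + Complex.I • x - (2 * Complex.I) • x := by module
    rw [h2, map_sub, map_smul, h1]
    module
  · have h1 := hR.star_apply (v - Complex.I • x)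
    rw [h] at h1
    have h2 : v + Complex.I • x = v - Complex.I • x + (2 * Complex.I) • x := by module
    rw [h2, map_add, map_smul, ← h1]

theorem adjointGraph_eq : adjointGraph A (ofResolvent R) = resolventGraph R := by
  ext ⟨y, z⟩
  rw [hR.mem_resolventGraph_iff_star]
  constructor
  · intro h
    refine ext_inner (A := A) fun w => ?_
    -- Testing the adjoint relation on `R w`, where `D R w = w - i R w`, gives `⟨w, y⟩ = ⟨w, R*(z -
    -- i y)⟩` for every `w`.
    obtain ⟨hx, hD⟩ := hR.exists_of_mem (x := R.1 w) (v := w - Complex.I • R.1 w) (by simp)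
    have h1 : inner A (ofResolvent R ⟨R.1 w, hx⟩) y = inner A (R.1 w) z := h ⟨R.1 w, hx⟩
    rw [hD, CStarModule.inner_sub_left, CStarModule.inner_smul_left_complex] at h1
    rw [← Adj.inner_left, CStarModule.inner_sub_right, CStarModule.inner_smul_right_complex, ← h1]
    simp
  · intro h x
    change inner A (ofResolvent R x) y = inner A x.1 z
    have hx := hR.apply_mem x
    set w := ofResolvent R x + Complex.I • x.1 with hw
    have hD : ofResolvent R x = w - Complex.I • x.1 := by rw [hw]; abel
    have h1 : inner A w y = inner A x.1 (z - Complex.I • y) := by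
      rw [← hx, Adj.inner_left, h]
    rw [hD, CStarModule.inner_sub_left, h1, CStarModule.inner_smul_left_complex,
      CStarModule.inner_sub_right, CStarModule.inner_smul_right_complex]
    simp

theorem isSelfAdjointOp : IsSelfAdjointOp A (ofResolvent R) := by
  rw [IsSelfAdjointOp, hR.adjointGraph_eq, hR.graph_eq]

theorem dense_domain : Dense ((ofResolvent R).domain : Set E) := by
  refine hR.denseRange.mono ?_
  rintro _ ⟨w, rfl⟩
  exact (hR.exists_of_mem (x := R.1 w) (v := w - Complex.I • R.1 w) (by simp)).1

theorem isRegular : IsRegular A (ofResolvent R) where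
  dense_domain := hR.dense_domain
  isClosed := by
    rw [LinearPMap.IsClosed, hR.graph_eq]
    exact isClosed_eq (f := fun p : E × E => R.1 (p.2 + Complex.I • p.1)) (by fun_prop)
      continuous_fst
  map_smul_alg a x := by
    refine hR.exists_of_mem ?_
    have h : a • ofResolvent R x + Complex.I • a • x.1
        = a • (ofResolvent R x + Complex.I • x.1) := by
      refine ext_inner (A := A) fun z => ?_
      simp [mul_add, mul_smul_comm]
    rw [h, R.map_smul_alg, hR.apply_mem]
  dense_adjoint := by
    refine hR.dense_domain.mono fun x hx => ⟨ofResolvent R ⟨x, hx⟩, ?_⟩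
    rw [hR.adjointGraph_eq, ← hR.graph_eq]
    exact LinearPMap.mem_graph _ ⟨x, hx⟩
  dense_range := by
    -- The range is everything: `x = R R* w` has `D x = R* w - i x` and `D D x = w - x`, so `(1 +
    -- D*D) x = w`.
    refine dense_univ.mono fun w _ => ?_
    have h0 := hR.star_apply w
    obtain ⟨hx, hD⟩ := hR.exists_of_mem (x := R.1 ((star R).1 w))
      (v := (star R).1 w - Complex.I • R.1 ((star R).1 w)) (by simp)
    refine ⟨⟨_, hx⟩, w - R.1 ((star R).1 w), ?_, by simp⟩
    rw [hD, hR.adjointGraph_eq, mem_resolventGraph]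
    have h1 : w - R.1 ((star R).1 w) + Complex.I • ((star R).1 w - Complex.I • R.1 ((star R).1 w))
        = w + Complex.I • (star R).1 w := by
      rw [smul_sub, smul_smul, Complex.I_mul_I]
      module
    rw [h1, map_add, map_smul]
    nth_rw 2 [h0]
    module

/-- The hypotheses are the resolvent identity between the points `z` and `-i`, in both orders: the
first makes `Q` a right inverse of `D - z`, the second a left inverse. -/
theorem isResolvent {Q : Adj A E} {z : ℂ} (h₁ : Q = R + (z + Complex.I) • (R * Q))
    (h₂ : Q = R + (z + Complex.I) • (Q * R)) : IsResolvent (ofResolvent R) z Q := by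
  constructor
  · intro y
    obtain ⟨hx, hD⟩ := hR.exists_of_mem (x := Q.1 y) (v := y + z • Q.1 y) (by
      rw [add_assoc, ← add_smul, map_add, map_smul]
      exact (congrArg (fun T : Adj A E => T.1 y) h₁).symm)
    exact ⟨⟨_, hx⟩, rfl, by rw [hD]; simp⟩
  · intro x
    have hx := hR.apply_mem x
    set w := ofResolvent R x + Complex.I • x.1 with hw
    have h1 : ofResolvent R x - z • x.1 = w - (z + Complex.I) • x.1 := by rw [hw]; module
    have h2 : Q.1 w = R.1 w + (z + Complex.I) • Q.1 (R.1 w) :=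
      congrArg (fun T : Adj A E => T.1 w) h₂
    rw [h1, map_sub, map_smul, h2, hx]
    simp

end IsResolventLike

/-! ### Uniqueness of resolvents and the Cayley transform of `D` -/

theorem IsResolvent.unique {D : E →ₗ.[ℂ] E} {z : ℂ} {Q Q' : Adj A E} (h : IsResolvent D z Q)
    (h' : IsResolvent D z Q') : Q = Q' := by
  refine Subtype.ext (ContinuousLinearMap.ext fun y => ?_)
  obtain ⟨x, hx, rfl⟩ := h.1 y
  rw [h.2, h'.2]

/-- `resolventOp` is defined by choice; uniqueness identifies the chosen operator. -/
theorem IsResolvent.resolventOp_eq {D : E →ₗ.[ℂ] E} {z : ℂ} {Q : Adj A E}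
    (h : IsResolvent D z Q) : resolventOp A D z = Q := by
  have hex : ∃ R : Adj A E, IsResolvent D z R := ⟨Q, h⟩
  rw [resolventOp, dif_pos hex]
  exact hex.choose_spec.unique h

theorem IsResolventLike.cayley_eq {R : Adj A E} (hR : IsResolventLike R) :
    cayley A (ofResolvent R) = 1 - (2 * Complex.I) • R := by
  rw [cayley, (hR.isResolvent (Q := R) (z := -Complex.I) (by simp) (by simp)).resolventOp_eq]

/-- The operators `R + R*` and `R R*` correspond to `2t / (t² + 1)` and `1 / (t² + 1)`, one odd and
one even. Written with them, the equation of the graph splits along a grading. -/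
theorem IsResolventLike.mem_resolventGraph_iff {R : Adj A E} (hR : IsResolventLike R) {x v : E} :
    (x, v) ∈ resolventGraph R ↔
      (R + star R).1 v = (2 : ℂ) • x - (2 : ℂ) • (R * star R).1 x ∧
      (R + star R).1 x = (2 : ℂ) • (R * star R).1 v := by
  have hadd (y : E) : (R + star R).1 y = R.1 y + (star R).1 y := rfl
  have hmul (y : E) : (R * star R).1 y = R.1 ((star R).1 y) := rfl
  simp only [hadd, hmul]
  have hx := hR.star_apply x
  have hv := hR.star_apply v
  constructor
  · intro h
    have h' := hR.mem_resolventGraph_iff_star.mp h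
    rw [mem_resolventGraph] at h
    have h1 := congrArg (star R).1 h
    have h1' := congrArg R.1 h'
    rw [← hR.comm_apply] at h1
    simp only [map_add, map_sub, map_smul] at h h' h1 h1'
    constructor
    · have hx' : Complex.I • (star R).1 x
          = Complex.I • R.1 x - (2 : ℂ) • R.1 ((star R).1 x) := by
        have h2 := congrArg (Complex.I • ·) hx
        simp only [smul_add, smul_smul, mul_left_comm Complex.I, Complex.I_mul_I] at h2
        rw [h2]
        module
      linear_combination (norm := module) h + h' + hx'
    · rw [← h1, ← h1']
      module
  · rintro ⟨h1, h2⟩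
    rw [mem_resolventGraph, map_add, map_smul]
    -- Since `R* - R = 2i R R*`, the operator is recovered as `R = ½ ((R + R*) - 2i R R*)`.
    have e1 : R.1 v = (2⁻¹ : ℂ) • ((R.1 v + (star R).1 v)
        - (2 * Complex.I) • R.1 ((star R).1 v)) := by
      linear_combination (norm := module) -(2⁻¹ : ℂ) • hv
    have e2 : R.1 x = (2⁻¹ : ℂ) • ((R.1 x + (star R).1 x)
        - (2 * Complex.I) • R.1 ((star R).1 x)) := by
      linear_combination (norm := module) -(2⁻¹ : ℂ) • hx
    rw [e1, e2, h1, h2]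
    simp only [smul_sub, smul_smul]
    have e3 : Complex.I * (2⁻¹ * (2 * Complex.I)) = -1 := by
      linear_combination Complex.I_mul_I
    rw [e3]
    module

theorem Grading.eq_of_add_eq_add {α : CStarGrading A} (𝒢 : Grading α E) {a₀ a₁ b₀ b₁ : E}
    (ha₀ : a₀ ∈ 𝒢.part 0) (ha₁ : a₁ ∈ 𝒢.part 1) (hb₀ : b₀ ∈ 𝒢.part 0) (hb₁ : b₁ ∈ 𝒢.part 1)
    (h : a₀ + a₁ = b₀ + b₁) : a₀ = b₀ ∧ a₁ = b₁ := by
  have h1 : a₀ - b₀ = b₁ - a₁ := by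
    rw [sub_eq_sub_iff_add_eq_add, h, add_comm]
  have h2 : a₀ - b₀ = 0 := Submodule.disjoint_def.mp 𝒢.isCompl_part.disjoint _
    (sub_mem ha₀ hb₀) (h1 ▸ sub_mem hb₁ ha₁)
  rw [h2] at h1
  exact ⟨sub_eq_zero.mp h2, (sub_eq_zero.mp h1.symm).symm⟩

theorem Grading.exists_add_eq {α : CStarGrading A} (𝒢 : Grading α E) (x : E) :
    ∃ x₀ ∈ 𝒢.part 0, ∃ x₁ ∈ 𝒢.part 1, x₀ + x₁ = x :=
  Submodule.mem_sup.mp (𝒢.isCompl_part.sup_eq_top ▸ Submodule.mem_top)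

/-- The operator with resolvent `R` has degree one if the "real part" of `R` is odd and the
"imaginary part" is even. -/
theorem IsResolventLike.hasDegreeOne {R : Adj A E} (hR : IsResolventLike R)
    {α : CStarGrading A} (𝒢 : Grading α E) (hodd : HasDegree 𝒢 1 (R + star R))
    (heven : HasDegree 𝒢 0 (R * star R)) : HasDegreeOne 𝒢 (ofResolvent R) := by
  -- Comparing even and odd components in the two graph equations pairs each part of `x` with the
  -- part of `v` of opposite degree.
  have split {x₀ x₁ v₀ v₁ : E} (hx₀ : x₀ ∈ 𝒢.part 0) (hx₁ : x₁ ∈ 𝒢.part 1)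
      (hv₀ : v₀ ∈ 𝒢.part 0) (hv₁ : v₁ ∈ 𝒢.part 1)
      (h : (x₀ + x₁, v₀ + v₁) ∈ resolventGraph R) :
      (x₀, v₁) ∈ resolventGraph R ∧ (x₁, v₀) ∈ resolventGraph R := by
    simp only [hR.mem_resolventGraph_iff, map_add] at h ⊢
    obtain ⟨h1, h2⟩ := h
    have e : (1 + 1 : ZMod 2) = 0 := rfl
    have hSv₀ := hodd 0 _ hv₀
    have hSx₀ := hodd 0 _ hx₀
    have hSv₁ := hodd 1 _ hv₁
    have hSx₁ := hodd 1 _ hx₁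
    have hCx₀ := heven 0 _ hx₀
    have hCx₁ := heven 1 _ hx₁
    have hCv₀ := heven 0 _ hv₀
    have hCv₁ := heven 1 _ hv₁
    rw [zero_add] at hSv₀ hSx₀
    rw [e] at hSv₁ hSx₁
    rw [add_zero] at hCx₀ hCx₁ hCv₀ hCv₁
    obtain ⟨k1, k2⟩ := 𝒢.eq_of_add_eq_add hSv₁ hSv₀
      (sub_mem (Submodule.smul_mem _ 2 hx₀) (Submodule.smul_mem _ 2 hCx₀))
      (sub_mem (Submodule.smul_mem _ 2 hx₁) (Submodule.smul_mem _ 2 hCx₁))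
      (by rw [add_comm, h1]; module)
    obtain ⟨k3, k4⟩ := 𝒢.eq_of_add_eq_add hSx₁ hSx₀ (Submodule.smul_mem _ 2 hCv₀)
      (Submodule.smul_mem _ 2 hCv₁) (by rw [add_comm, h2]; module)
    exact ⟨⟨k1, k4⟩, k2, k3⟩
  constructor
  · intro x hx
    obtain ⟨x₀, hx₀, x₁, hx₁, hxx⟩ := 𝒢.exists_add_eq x
    obtain ⟨v₀, hv₀, v₁, hv₁, hv⟩ := 𝒢.exists_add_eq (ofResolvent R ⟨x, hx⟩)
    have h : (x₀ + x₁, v₀ + v₁) ∈ resolventGraph R := by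
      rw [hv, hxx]; exact hR.apply_mem ⟨x, hx⟩
    obtain ⟨h0, h1⟩ := split hx₀ hx₁ hv₀ hv₁ h
    exact ⟨x₀, (hR.exists_of_mem h0).1, x₁, (hR.exists_of_mem h1).1, hx₀, hx₁, hxx⟩
  · intro n x hx
    have h : (x.1, ofResolvent R x) ∈ resolventGraph R := hR.apply_mem x
    obtain ⟨v₀, hv₀, v₁, hv₁, hv⟩ := 𝒢.exists_add_eq (ofResolvent R x)
    rw [← hv] at h ⊢
    -- For homogeneous `x` the other component is `0`, so the part of `D x` paired with it vanishes.
    have zero_of {v : E} (hv : ((0 : E), v) ∈ resolventGraph R) : v = 0 :=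
      hR.eq_zero_of_apply (by simpa [mem_resolventGraph] using hv)
    have hn : ∀ n : ZMod 2, n = 0 ∨ n = 1 := by decide
    rcases hn n with rfl | rfl
    · rw [← add_zero x.1] at h
      rw [zero_of (split hx (zero_mem _) hv₀ hv₁ h).2, zero_add, zero_add]
      exact hv₁
    · rw [← zero_add x.1] at h
      rw [zero_of (split (zero_mem _) hx hv₀ hv₁ h).1, add_zero]
      exact hv₀

/-! ### The essential submodule -/

section essential

variable (φ : C₀(ℝ, ℂ) →⋆ₙₐ[ℂ] Adj A E)

theorem apply_mem_essentialSubspace (f : C₀(ℝ, ℂ)) (x : E) :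
    (φ f).1 x ∈ essentialSubspace φ :=
  Submodule.le_topologicalClosure _ (Submodule.subset_span ⟨f, x, rfl⟩)

theorem continuous_smul_alg (a : A) : Continuous fun x : E => a • x := by
  refine AddMonoidHomClass.continuous_of_bound
    (AddMonoidHom.mk' (fun x : E => a • x) (smul_add_alg a)) ‖a‖ fun x => norm_smul_alg_le a x

/-- A continuous linear map that sends each `φ(f) x` into the essential subspace preserves it. -/
theorem map_mem_essentialSubspace {T : E → E} (hT : Continuous T)
    (hadd : ∀ x y, T (x + y) = T x + T y)
    (hsmul : ∀ (c : ℂ) x, T (c • x) = c • T x)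
    (h : ∀ f x, T ((φ f).1 x) ∈ essentialSubspace φ) {x : E} (hx : x ∈ essentialSubspace φ) :
    T x ∈ essentialSubspace φ := by
  let L : E →L[ℂ] E := ⟨⟨⟨T, hadd⟩, hsmul⟩, hT⟩
  have h1 : essentialSubspace φ ≤ (essentialSubspace φ).comap L.toLinearMap := by
    refine Submodule.topologicalClosure_minimal _ (Submodule.span_le.mpr ?_)
      ((Submodule.isClosed_topologicalClosure _).preimage hT)
    rintro _ ⟨f, x, rfl⟩
    exact h f x
  exact h1 hx

/-- The closed linear span of `φ(C₀(ℝ)) E`, as a closed `A`-submodule. -/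
def essentialSubmodule : HilbertSubmodule A E where
  toSubmodule := essentialSubspace φ
  smul_alg_mem a x hx := map_mem_essentialSubspace φ (continuous_smul_alg a) (smul_add_alg a)
    (fun c x => ext_inner (A := A) fun z => by simp [mul_smul_comm])
    (fun f x => by
      rw [← Adj.map_smul_alg]
      exact apply_mem_essentialSubspace φ f _) hx
  isClosed := Submodule.isClosed_topologicalClosure _

theorem isInvariant_essentialSubmodule : (essentialSubmodule φ).IsInvariant φ :=
  fun f x _ => apply_mem_essentialSubspace φ f x

theorem essentialSubspace_eq_top (h : IsNondegenerate φ) : essentialSubspace φ = ⊤ :=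
  Submodule.dense_iff_topologicalClosure_eq_top.mp h

end essential

/-! ### Even and odd functions, and the grading of the essential submodule -/

theorem evenOddGrading_aut_apply (f : C₀(ℝ, ℂ)) (t : ℝ) : evenOddGrading.aut f t = f (-t) := rfl

theorem mem_evenOddGrading_zero {f : C₀(ℝ, ℂ)} (h : ∀ t, f (-t) = f t) :
    f ∈ evenOddGrading.part 0 := by
  change evenOddGrading.aut f = (-1 : ℂ) ^ 0 • f
  ext t
  simp [evenOddGrading_aut_apply, h]

theorem mem_evenOddGrading_one {f : C₀(ℝ, ℂ)} (h : ∀ t, f (-t) = -f t) :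
    f ∈ evenOddGrading.part 1 := by
  change evenOddGrading.aut f = (-1 : ℂ) ^ 1 • f
  ext t
  simp [evenOddGrading_aut_apply, h]

theorem isGraded_essentialSubmodule [CompleteSpace E] {α : CStarGrading A} (𝒢 : Grading α E)
    {φ : C₀(ℝ, ℂ) →⋆ₙₐ[ℂ] Adj A E} (hφ : IsGradedHom 𝒢 φ) :
    (essentialSubmodule φ).IsGraded 𝒢 := by
  -- Closed complements in a Banach space have continuous projections. It therefore suffices that
  -- the projection `P` onto `E₀` maps each generator `φ(f) x` into the essential subspace.
  let e := (𝒢.part 0).prodEquivOfIsTopCompl (𝒢.part 1)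
    (Submodule.IsCompl.isTopCompl_of_isClosed 𝒢.isCompl_part (𝒢.isClosed_part 0)
      (𝒢.isClosed_part 1))
  let P : E → E := fun x => ((e.symm x).1 : E)
  have hP {x₀ x₁ : E} (h₀ : x₀ ∈ 𝒢.part 0) (h₁ : x₁ ∈ 𝒢.part 1) : P (x₀ + x₁) = x₀ := by
    have : e.symm (x₀ + x₁) = (⟨x₀, h₀⟩, ⟨x₁, h₁⟩) := by
      rw [ContinuousLinearEquiv.symm_apply_eq]; rfl
    simp [P, this]
  have key : ∀ {x : E}, x ∈ essentialSubspace φ → P x ∈ essentialSubspace φ := by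
    refine map_mem_essentialSubspace φ (by fun_prop) (by simp [P]) (by simp [P]) fun f x => ?_
    obtain ⟨x₀, h₀, x₁, h₁, rfl⟩ := 𝒢.exists_add_eq x
    obtain ⟨f₀, hf₀, f₁, hf₁, rfl⟩ : ∃ f₀ ∈ evenOddGrading.part 0, ∃ f₁ ∈ evenOddGrading.part 1,
        f₀ + f₁ = f := by
      refine ⟨(2⁻¹ : ℂ) • (f + evenOddGrading.aut f), mem_evenOddGrading_zero fun t => ?_,
        (2⁻¹ : ℂ) • (f - evenOddGrading.aut f), mem_evenOddGrading_one fun t => ?_, by module⟩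
      · simp [evenOddGrading_aut_apply, add_comm]
      · simp only [ZeroAtInftyContinuousMap.smul_apply, ZeroAtInftyContinuousMap.sub_apply,
          evenOddGrading_aut_apply, neg_neg, smul_eq_mul]
        ring
    have e1 : (φ (f₀ + f₁)).1 (x₀ + x₁) = ((φ f₀).1 x₀ + (φ f₁).1 x₁)
        + ((φ f₁).1 x₀ + (φ f₀).1 x₁) := by
      rw [map_add φ]
      change (φ f₀).1 (x₀ + x₁) + (φ f₁).1 (x₀ + x₁) = _
      simp only [map_add]
      abel
    have d00 := hφ 0 f₀ hf₀ 0 _ h₀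
    have d11 := hφ 1 f₁ hf₁ 1 _ h₁
    have d10 := hφ 1 f₁ hf₁ 0 _ h₀
    have d01 := hφ 0 f₀ hf₀ 1 _ h₁
    rw [add_zero] at d00 d01
    rw [zero_add] at d10
    rw [e1, hP (add_mem d00 d11) (add_mem d10 d01)]
    exact add_mem (apply_mem_essentialSubspace φ _ _) (apply_mem_essentialSubspace φ _ _)
  intro x hx
  obtain ⟨x₀, h₀, x₁, h₁, rfl⟩ := 𝒢.exists_add_eq x
  have h2 := key hx
  rw [hP h₀ h₁] at h2
  refine ⟨x₀, h2, x₁, ?_, h₀, h₁, rfl⟩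
  have h3 := sub_mem hx h2
  rwa [add_sub_cancel_left] at h3

/-! ### Restriction to a closed submodule -/

namespace HilbertSubmodule

variable (F : HilbertSubmodule A E)

/-- The restriction of an adjointable operator to a submodule that is invariant under it and its
adjoint. -/
def restrict (T : Adj A E) (h : ∀ x ∈ F.toSubmodule, T.1 x ∈ F.toSubmodule)
    (h' : ∀ x ∈ F.toSubmodule, (star T).1 x ∈ F.toSubmodule) : Adj A F.toSubmodule :=
  ⟨(T.1.comp F.toSubmodule.subtypeL).codRestrict F.toSubmodule fun x => h _ x.2,
    fun a x => Subtype.ext (T.map_smul_alg a x.1),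
    ((star T).1.comp F.toSubmodule.subtypeL).codRestrict F.toSubmodule fun x => h' _ x.2,
    fun x y => T.inner_left x.1 y.1⟩

theorem adj_ext {T S : Adj A F.toSubmodule} (h : ∀ x, ((T.1 x : F.toSubmodule) : E) = S.1 x) :
    T = S :=
  Subtype.ext (ContinuousLinearMap.ext fun x => Subtype.ext (h x))

variable {F}

/-- The restriction of a `*`-homomorphism to an invariant submodule. -/
def IsInvariant.restrictHom {φ : C₀(ℝ, ℂ) →⋆ₙₐ[ℂ] Adj A E} (hF : F.IsInvariant φ) :
    C₀(ℝ, ℂ) →⋆ₙₐ[ℂ] Adj A F.toSubmodule where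
  toFun f := F.restrict (φ f) (hF f) (by rw [← map_star]; exact hF _)
  map_smul' c f := F.adj_ext fun x => by simp only [map_smul]; rfl
  map_zero' := F.adj_ext fun x => by simp only [map_zero]; rfl
  map_add' f g := F.adj_ext fun x => by simp only [map_add]; rfl
  map_mul' f g := F.adj_ext fun x => by simp only [map_mul]; rfl
  map_star' f := by
    refine (Adj.star_unique _ _ fun x y => ?_).symm
    change inner A ((φ f).1 x.1) y.1 = inner A x.1 ((φ (star f)).1 y.1)
    rw [map_star, Adj.inner_left]

@[simp]
theorem IsInvariant.coe_restrictHom_apply {φ : C₀(ℝ, ℂ) →⋆ₙₐ[ℂ] Adj A E} (hF : F.IsInvariant φ)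
    (f : C₀(ℝ, ℂ)) (x : F.toSubmodule) :
    (((hF.restrictHom f).1 x : F.toSubmodule) : E) = (φ f).1 x.1 := rfl

end HilbertSubmodule

section restriction

variable (φ : C₀(ℝ, ℂ) →⋆ₙₐ[ℂ] Adj A E)

/-- The corestriction of `φ` to the essential submodule. -/
abbrev essentialHom : C₀(ℝ, ℂ) →⋆ₙₐ[ℂ] Adj A (essentialSubmodule φ).toSubmodule :=
  (isInvariant_essentialSubmodule φ).restrictHom

theorem continuous_hom [CompleteSpace E] : Continuous φ :=
  AddMonoidHomClass.continuous_of_bound φ 1 fun g => by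
    rw [one_mul]
    exact NonUnitalStarAlgHom.norm_apply_le φ g

theorem continuous_hom_apply [CompleteSpace E] (x : E) : Continuous fun f => (φ f).1 x :=
  (ContinuousLinearMap.apply ℂ E x).continuous.comp
    (continuous_subtype_val.comp (continuous_hom φ))

/-- The operator `(D + i)⁻¹` on the essential submodule. -/
abbrev essentialResolvent : Adj A (essentialSubmodule φ).toSubmodule :=
  essentialHom φ resolventNegI

theorem isResolventLike_essentialResolvent [CompleteSpace E] :
    IsResolventLike (essentialResolvent φ) where
  star_eq := by
    rw [← map_star, ← map_mul, ← map_smul, ← map_add, ← star_resolventNegI]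
  comm := by
    rw [← map_star, ← map_mul, ← map_mul, mul_comm]
  denseRange := by
    set F := essentialSubmodule φ
    set R := essentialResolvent φ
    have h1 : essentialSubspace φ
        ≤ ((LinearMap.range R.1.toLinearMap).map F.toSubmodule.subtype).topologicalClosure := by
      refine Submodule.topologicalClosure_minimal _ (Submodule.span_le.mpr ?_)
        (Submodule.isClosed_topologicalClosure _)
      rintro _ ⟨f, x, rfl⟩
      -- Approximating `f` by products `r g` makes `φ(f) x` a limit of the vectors `R (φ(g) x)`.
      have h2 := (dense_range_resolventFun_mul _ neg_I_im_ne_zero f)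
      refine map_mem_closure (f := fun f => (φ f).1 x) (continuous_hom_apply φ x) h2 ?_
      rintro _ ⟨g, rfl⟩
      refine ⟨R.1 ⟨(φ g).1 x, apply_mem_essentialSubspace φ g x⟩, ⟨_, rfl⟩, ?_⟩
      simp only [map_mul φ]
      rfl
    intro x
    rw [closure_subtype]
    refine closure_mono ?_ (h1 x.2)
    rintro _ ⟨_, ⟨y, rfl⟩, rfl⟩
    exact ⟨_, ⟨y, rfl⟩, rfl⟩

end restriction

/-! ### Strict homomorphisms -/

variable (φ : C₀(ℝ, ℂ) →⋆ₙₐ[ℂ] Adj A E)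

/-- For `p = lim φ(u) x`, multiplication by `φ(f*)` gives `φ(f*) p = lim φ(f* u) x = φ(f*) x`. Hence
`x - p` is orthogonal to every `φ(f) y`. -/
theorem tendsto_approximateUnit_inner [CompleteSpace E] {l : Filter C₀(ℝ, ℂ)}
    (hl : l.IsApproximateUnit) {w : E} (hw : w ∈ essentialSubspace φ) {x p : E}
    (hp : Filter.Tendsto (fun u => (φ u).1 x) l (nhds p)) :
    (inner A w (x - p) : A) = 0 := by
  have := hl.neBot
  have hinner (y : E) : Continuous fun w : E => (inner A w y : A) :=
    CStarModule.continuous_inner.comp (by fun_prop : Continuous fun w : E => (w, y))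
  have hsub : essentialSubspace φ ≤ (⟨⟨⟨{w | (inner A w (x - p) : A) = 0},
      fun {a b} ha hb => by
        simp only [Set.mem_ofPred_eq, CStarModule.inner_add_left] at *
        rw [ha, hb, add_zero]⟩, by simp⟩, fun c a ha => by
        simp only [Set.mem_ofPred_eq, CStarModule.inner_smul_left_complex] at *
        rw [ha, smul_zero]⟩ : Submodule ℂ E) := by
    refine Submodule.topologicalClosure_minimal _ (Submodule.span_le.mpr ?_)
      (isClosed_eq (hinner _) continuous_const)
    rintro _ ⟨f, y, rfl⟩
    change inner A ((φ f).1 y) (x - p) = 0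
    have h1 : Filter.Tendsto (fun u => (φ (star f * u)).1 x) l (nhds ((φ (star f)).1 x)) :=
      ((continuous_hom_apply φ x).tendsto _).comp (hl.tendsto_mul_left (star f))
    have h2 : Filter.Tendsto (fun u => (φ (star f * u)).1 x) l (nhds ((φ (star f)).1 p)) := by
      simp only [map_mul φ]
      exact ((φ (star f)).1.continuous.tendsto p).comp hp
    rw [Adj.inner_left, ← map_star, map_sub, tendsto_nhds_unique h1 h2, sub_self,
      CStarModule.inner_zero_right]
  exact hsub hw

theorem isComplemented_of_isStrict [CompleteSpace E] (h : IsStrict φ) :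
    (essentialSubmodule φ).IsComplemented := by
  intro x
  obtain ⟨l, hl, hc⟩ := h
  have := hl.neBot
  obtain ⟨p, hp⟩ := CompleteSpace.complete (hc x).1
  have hp' : Filter.Tendsto (fun u => (φ u).1 x) l (nhds p) := by
    rwa [Filter.map_map] at hp
  refine ⟨p, ?_, x - p, fun w hw => tendsto_approximateUnit_inner φ hl hw hp', by abel⟩
  exact (essentialSubmodule φ).isClosed.mem_of_tendsto hp'
    (Filter.Eventually.of_forall fun u => apply_mem_essentialSubspace φ u x)

/-- Replacing `x` by its projection does not change `⟨v, φ(f) x⟩ = ⟨φ(f*) v, x⟩`, since `φ(f*) v`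
lies in the submodule. -/
theorem extend_essentialHom (hc : (essentialSubmodule φ).IsComplemented) (f : C₀(ℝ, ℂ)) :
    hc.extend (essentialHom φ f) = φ f := by
  refine Subtype.ext (ContinuousLinearMap.ext fun x => ext_inner (A := A) fun v => ?_)
  change inner A v ((φ f).1 (hc.proj x).1) = inner A v ((φ f).1 x)
  rw [Adj.inner_right, Adj.inner_right, ← map_star]
  exact hc.inner_proj x ⟨_, apply_mem_essentialSubspace φ (star f) v⟩

/-! ### Compact operators -/

/-- The compression `T ↦ φ(a) T φ(b)` to the essential submodule. -/
def compression (a b : C₀(ℝ, ℂ)) : Adj A E →L[ℂ] Adj A (essentialSubmodule φ).toSubmodule :=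
  LinearMap.mkContinuous
    { toFun := fun T => (essentialSubmodule φ).restrict (φ a * T * φ b)
        (fun x _ => apply_mem_essentialSubspace φ a (T.1 ((φ b).1 x)))
        (fun x _ => by
          rw [star_mul, star_mul, ← map_star φ b]
          exact apply_mem_essentialSubspace φ (star b) _)
      map_add' := fun T S => HilbertSubmodule.adj_ext _ fun x => by
        change (φ a).1 (T.1 ((φ b).1 x.1) + S.1 ((φ b).1 x.1)) = _
        rw [map_add]; rfl
      map_smul' := fun c T => HilbertSubmodule.adj_ext _ fun x => by
        change (φ a).1 (c • T.1 ((φ b).1 x.1)) = _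
        rw [map_smul]; rfl }
    (‖φ a‖ * ‖φ b‖) fun T => by
      refine ContinuousLinearMap.opNorm_le_bound _ (by positivity) fun x => ?_
      change ‖(φ a * T * φ b).1 x.1‖ ≤ _
      refine ((φ a * T * φ b).1.le_opNorm x.1).trans ?_
      have h1 : ‖φ a * T * φ b‖ ≤ ‖φ a‖ * ‖φ b‖ * ‖T‖ := by
        refine (norm_mul_le _ _).trans ?_
        calc ‖φ a * T‖ * ‖φ b‖ ≤ ‖φ a‖ * ‖T‖ * ‖φ b‖ := by gcongr; exact norm_mul_le _ _
          _ = _ := by ring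
      exact mul_le_mul_of_nonneg_right h1 (norm_nonneg _)

theorem coe_compression_apply (a b : C₀(ℝ, ℂ)) (T : Adj A E)
    (x : (essentialSubmodule φ).toSubmodule) :
    (((compression φ a b T).1 x : (essentialSubmodule φ).toSubmodule) : E)
      = (φ a).1 (T.1 ((φ b).1 x.1)) := rfl

/-- The point of compressing on both sides: both vectors of the new rank-one operator lie in the
essential submodule, even though `x` and `y` need not. -/
theorem compression_rankOne (a b : C₀(ℝ, ℂ)) (x y : E) :
    compression φ a b (rankOne A x y) = rankOne A
      (⟨(φ a).1 x, apply_mem_essentialSubspace φ a x⟩ : (essentialSubmodule φ).toSubmodule)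
      ⟨(φ (star b)).1 y, apply_mem_essentialSubspace φ (star b) y⟩ := by
  refine HilbertSubmodule.adj_ext _ fun w => ?_
  change (φ a).1 ((inner A y ((φ b).1 w.1) : A) • x)
    = (inner A ((φ (star b)).1 y) w.1 : A) • (φ a).1 x
  rw [Adj.map_smul_alg, Adj.inner_right, ← map_star]

set_option synthInstance.maxHeartbeats 200000 in
theorem isClosed_compacts : IsClosed (compacts A E : Set (Adj A E)) :=
  Submodule.isClosed_topologicalClosure _

set_option synthInstance.maxHeartbeats 200000 in
theorem compression_mem_compacts (a b : C₀(ℝ, ℂ)) {T : Adj A E} (hT : T ∈ compacts A E) :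
    compression φ a b T ∈ compacts A (essentialSubmodule φ).toSubmodule := by
  have h : compacts A E ≤ (compacts A (essentialSubmodule φ).toSubmodule).comap
      (compression φ a b).toLinearMap := by
    refine Submodule.topologicalClosure_minimal _ (Submodule.span_le.mpr ?_)
      (isClosed_compacts.preimage (compression φ a b).continuous)
    rintro _ ⟨x, y, rfl⟩
    refine Submodule.le_topologicalClosure _ (Submodule.subset_span ?_)
    exact ⟨_, _, compression_rankOne φ a b x y⟩
  exact h hT

theorem essentialHom_mem_compacts [CompleteSpace E] (h : ∀ f, φ f ∈ compacts A E)
    (f : C₀(ℝ, ℂ)) : essentialHom φ f ∈ compacts A (essentialSubmodule φ).toSubmodule := by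
  have hd := dense_range_resolventFun_mul _ neg_I_im_ne_zero
  have hcont : Continuous fun g : C₀(ℝ, ℂ) => resolventNegI * g := by fun_prop
  -- Products `r (r g)` are dense in `C₀(ℝ)`, and `φ(r g r) = φ(r) φ(g) φ(r)` is a compression of
  -- the compact operator `φ(g)`.
  refine isClosed_property (hd.comp hd hcont)
    (isClosed_compacts.preimage (continuous_hom (essentialHom φ)))
    (fun g => ?_) f
  change essentialHom φ (resolventNegI * (resolventNegI * g)) ∈ _
  have h1 : essentialHom φ (resolventNegI * (resolventNegI * g))
      = compression φ resolventNegI resolventNegI (φ g) := by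
    rw [mul_comm resolventNegI g]
    refine HilbertSubmodule.adj_ext _ fun x => ?_
    rw [HilbertSubmodule.IsInvariant.coe_restrictHom_apply, coe_compression_apply, map_mul φ,
      map_mul φ]
    rfl
  rw [h1]
  exact compression_mem_compacts φ _ _ (h g)

/-! ### The converse functional calculus -/

/-- The self-adjoint regular operator `D` with `φ(f) = f(D)` on the essential submodule. -/
abbrev essentialOperator :
    (essentialSubmodule φ).toSubmodule →ₗ.[ℂ] (essentialSubmodule φ).toSubmodule :=
  ofResolvent (essentialResolvent φ)

theorem functionalCalculus_essentialOperator [CompleteSpace E] (f : C₀(ℝ, ℂ)) :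
    functionalCalculus A (essentialOperator φ) f = essentialHom φ f := by
  rw [functionalCalculus, (isResolventLike_essentialResolvent φ).cayley_eq]
  exact cfc_circleFun (essentialHom φ) f

theorem isResolvent_essentialOperator [CompleteSpace E] (z : ℂ) (hz : z.im ≠ 0) :
    IsResolvent (essentialOperator φ) z (essentialHom φ (resolventFun z hz)) := by
  have h := resolventFun_eq_add z (-Complex.I) hz neg_I_im_ne_zero
  rw [sub_neg_eq_add] at h
  refine (isResolventLike_essentialResolvent φ).isResolvent ?_ ?_
  · rw [← map_mul, ← map_smul, ← map_add, ← h]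
  · rw [← map_mul, ← map_smul, ← map_add, mul_comm, ← h]

theorem hasCompactResolvents_essentialOperator [CompleteSpace E]
    (h : ∀ f, φ f ∈ compacts A E) : HasCompactResolvents A (essentialOperator φ) :=
  fun z hz => ⟨_, essentialHom_mem_compacts φ h _, isResolvent_essentialOperator φ z hz⟩

theorem resolventNegI_add_star_mem :
    resolventNegI + star resolventNegI ∈ evenOddGrading.part 1 := by
  refine mem_evenOddGrading_one fun t => ?_
  have h1 : (t : ℂ) + Complex.I ≠ 0 := by simpa using ofReal_sub_ne_zero neg_I_im_ne_zero t
  have h2 : (t : ℂ) - Complex.I ≠ 0 := ofReal_sub_ne_zero I_im_ne_zero t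
  have h3 : -(t : ℂ) + Complex.I ≠ 0 := fun h => h2 (by linear_combination -h)
  have h4 : -(t : ℂ) - Complex.I ≠ 0 := fun h => h1 (by linear_combination -h)
  rw [star_resolventNegI_eq]
  simp only [ZeroAtInftyContinuousMap.add_apply, resolventFun_apply, Complex.ofReal_neg,
    sub_neg_eq_add]
  field_simp
  ring

theorem resolventNegI_mul_star_mem :
    resolventNegI * star resolventNegI ∈ evenOddGrading.part 0 := by
  refine mem_evenOddGrading_zero fun t => ?_
  rw [star_resolventNegI_eq]
  simp only [ZeroAtInftyContinuousMap.mul_apply, resolventFun_apply, Complex.ofReal_neg,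
    sub_neg_eq_add, ← mul_inv]
  ring_nf

theorem hasDegreeOne_essentialOperator [CompleteSpace E] {α : CStarGrading A} (𝒢 : Grading α E)
    {φ : C₀(ℝ, ℂ) →⋆ₙₐ[ℂ] Adj A E} (hφ : IsGradedHom 𝒢 φ) :
    HasDegreeOne ((essentialSubmodule φ).grading 𝒢 (isGraded_essentialSubmodule 𝒢 hφ))
      (essentialOperator φ) := by
  refine (isResolventLike_essentialResolvent φ).hasDegreeOne _ ?_ ?_
  · rw [← map_star, ← map_add]
    exact fun n x hx => hφ 1 _ resolventNegI_add_star_mem n x.1 hx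
  · rw [← map_star, ← map_mul]
    exact fun n x hx => hφ 0 _ resolventNegI_mul_star_mem n x.1 hx

end HilbertMod

end

open HilbertMod in
theorem theorem3p2 {A E : Type*}
    [NonUnitalCStarAlgebra A] [PartialOrder A] [StarOrderedRing A] (α : CStarGrading A)
    [NormedAddCommGroup E] [NormedSpace ℂ E] [SMul A E] [CStarModule A E] [CompleteSpace E]
    (𝒢 : Grading α E)
    (φ : C₀(ℝ, ℂ) →⋆ₙₐ[ℂ] Adj A E) (hφ : IsGradedHom 𝒢 φ) :
    ∃ (F : HilbertSubmodule A E) (hF : F.IsGraded 𝒢)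
      (D : F.toSubmodule →ₗ.[ℂ] F.toSubmodule),
      F.toSubmodule = essentialSubspace φ ∧
      F.IsInvariant φ ∧
      IsRegular A D ∧ IsSelfAdjointOp A D ∧ HasDegreeOne (F.grading 𝒢 hF) D ∧
      (∀ (f : C₀(ℝ, ℂ)) (x : F.toSubmodule),
        (φ f).1 x.1 = ((functionalCalculus A D f).1 x).1) ∧
      (IsStrict φ → ∃ hc : F.IsComplemented, ∀ f : C₀(ℝ, ℂ),
        φ f = hc.extend (functionalCalculus A D f)) ∧
      (IsNondegenerate φ → F.toSubmodule = ⊤) ∧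
      ((∀ f : C₀(ℝ, ℂ), φ f ∈ compacts A E) → HasCompactResolvents A D) := by
  have hR := isResolventLike_essentialResolvent φ
  refine ⟨essentialSubmodule φ, isGraded_essentialSubmodule 𝒢 hφ, essentialOperator φ, rfl,
    isInvariant_essentialSubmodule φ, hR.isRegular, hR.isSelfAdjointOp,
    hasDegreeOne_essentialOperator 𝒢 hφ, fun f x => ?_,
    fun h => ⟨isComplemented_of_isStrict φ h, fun f => ?_⟩, essentialSubspace_eq_top φ,
    hasCompactResolvents_essentialOperator φ⟩
  · rw [functionalCalculus_essentialOperator]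
    rfl
  · rw [functionalCalculus_essentialOperator, extend_essentialHom]
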